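/- All Banach spaces are real and all operators are bounded and linear. For a finite measure $\mu$, a Banach function space $X(\mu)$ is a linear subspace of $L^0(\mu)$ (real measurable functions modulo $\mu$-a.e. equality) with a complete norm, which contains all simple functions and such that $|f|\le|g|$ a.e. and $g\in X(\mu)$ imply $f\in X(\mu)$ and $\|f\|\le\|g\|$. It carries the $\mu$-a.e. order and its dual $X(\mu)^*$ carries the dual order. A Banach lattice is called order continuous if $f_n\downarrow 0$ implies $\|f_n\|\to0$. In any Banach lattice, $(\sum_i|x_i|^p)^{1/p}$ denotes $\sup\{\sum_i a_ix_i : (a_i)\in B_{\ell^{p'}}\}$, which in a Banach function space is the pointwise expression. For $x_1,\dots,x_n$ in a Banach space $E$ put $$w_p(x_1,\dots,x_n)=\sup_{x^*\in B_{E^*}}\Big(\sum_{i=1}^n|\langle x_i,x^*\rangle|^p\Big)^{1/p}.$$ A Banach function space $X$ is $p$-convex (respectively $p$-concave) if there is a constant $K$ with $\|(\sum_i|f_i|^p)^{1/p}\|\le K(\sum_i\|f_i\|^p)^{1/p}$ (respectively $(\sum_i\|f_i\|^p)^{1/p}\le K\|(\sum_i|f_i|^p)^{1/p}\|$) for all finite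 families $(f_i)$ in $X$. An operator $S$ from a Banach space to a Banach space (respectively, to a Banach lattice) is $p$-summing (respectively lattice $p$-summing) if there is a constant $K$ with $(\sum_i\|Sx_i\|^p)^{1/p}\le K\,w_p(x_1,\dots,x_n)$ (respectively $\|(\sum_i|Sx_i|^p)^{1/p}\|\le K\,w_p(x_1,\dots,x_n)$) for all finite families $(x_i)$. An operator $S:X\to Y$ between Banach lattices is $p$-regular if there is a constant $K$ with $\|(\sum_i|Sx_i|^p)^{1/p}\|\le K\|(\sum_i|x_i|^p)^{1/p}\|$ for all finite families $(x_i)$ in $X$. **Corollary.** Let $T:E\to F$ be an operator between Banach spaces, let $1<p<\infty$ and $\frac1p+\frac1{p'}=1$. The following assertions are equivalent. (i) There exist finite measures $\mu,\nu$, a $p$-convex order continuous Banach function space $X(\mu)$, a $p$-concave Banach function space $Y(\nu)$ whose dual $Y(\nu)^*$ is order continuous, and operators $S_0:E\to X(\mu)$, $T_0:X(\mu)\to Y(\nu)$, $R_0:Y(\nu)\to F$ such that $T=R_0\circ T_0\circ S_0$, where $S_0$ is lattice $p$-summing, $T_0$ is $p$-regular and $R_0^*:F^*\to Y(\nu)^*$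 is lattice $p'$-summing. (ii) There exist finite measures $\mu,\nu$ and operators $S_1:E\to L^p(\mu)$, $T_1:L^p(\mu)\to L^p(\nu)$, $R_1:L^p(\nu)\to F$ such that $T=R_1\circ T_1\circ S_1$, where $S_1$ is $p$-summing and $R_1^*:F^*\to L^p(\nu)^*$ is $p'$-summing. Moreover, if (i) and (ii) hold, then $T$ is $p$-dominated, that is, there is a constant $K$ such that for all $x_1,\dots,x_n\in E$ and $y_1^*,\dots,y_n^*\in F^*$ $$\sum_{i=1}^n|\langle Tx_i,y_i^*\rangle|\le K\,w_p(x_1,\dots,x_n)\,\sup_{y\in B_F}\Big(\sum_{i=1}^n|\langle y,y_i^*\rangle|^{p'}\Big)^{1/p'},$$ and $T$ is $p$-factorable, that is, $\kappa_F\circ T$ factors through bounded operators $E\to L^p(\lambda)\to F^{**}$ for some measure $\lambda$, where $\kappa_F:F\to F^{**}$ is the canonical embedding. -/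

import Mathlib

open MeasureTheory Filter Topology

universe w u v

/-- The exponent of `L^p`: a real number `p > 1` is an admissible `ℝ≥0∞`-valued exponent. -/
instance fact_one_le_ofReal (p : ℝ) [hp : Fact (1 < p)] : Fact (1 ≤ ENNReal.ofReal p) :=
  ⟨by simpa using ENNReal.ofReal_le_ofReal hp.out.le⟩

/-! ### Banach function spaces -/

/-- A (real) Banach function space over `μ`: a linear subspace of `L⁰(μ)` with a complete norm, which
contains all simple functions and such that `|f| ≤ |g|` a.e. and `g ∈ X` imply `f ∈ X` and
`‖f‖ ≤ ‖g‖`. (It is only used for finite measures.) -/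
structure BanachFunctionSpace {Ω : Type*} [MeasurableSpace Ω] (μ : Measure Ω) where
  carrier : Submodule ℝ (Ω →ₘ[μ] ℝ)
  norm : carrier → ℝ
  norm_nonneg : ∀ f, 0 ≤ norm f
  norm_smul : ∀ (c : ℝ) (f), norm (c • f) = |c| * norm f
  norm_add_le : ∀ f g, norm (f + g) ≤ norm f + norm g
  eq_zero_of_norm_eq_zero : ∀ f, norm f = 0 → f = 0
  complete : ∀ u : ℕ → carrier,
    (∀ ε > 0, ∃ N, ∀ m ≥ N, ∀ n ≥ N, norm (u m - u n) < ε) →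
      ∃ f, ∀ ε > 0, ∃ N, ∀ n ≥ N, norm (u n - f) < ε
  simple_mem : ∀ s : SimpleFunc Ω ℝ, AEEqFun.mk s s.aestronglyMeasurable ∈ carrier
  solid : ∀ (f : Ω →ₘ[μ] ℝ) (g : carrier), (∀ᵐ ω ∂μ, |f ω| ≤ |(g : Ω →ₘ[μ] ℝ) ω|) →
    ∃ hf : f ∈ carrier, norm ⟨f, hf⟩ ≤ norm g

namespace BanachFunctionSpace

/-- The elements of a Banach function space, as a type. -/
def Elem {Ω : Type*} [MeasurableSpace Ω] {μ : Measure Ω} (X : BanachFunctionSpace μ) : Type _ :=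
  X.carrier

instance {Ω : Type*} [MeasurableSpace Ω] {μ : Measure Ω} :
    CoeSort (BanachFunctionSpace μ) (Type _) := ⟨Elem⟩

instance {Ω : Type*} [MeasurableSpace Ω] {μ : Measure Ω} (X : BanachFunctionSpace μ) :
    AddCommGroup X := inferInstanceAs (AddCommGroup X.carrier)

instance {Ω : Type*} [MeasurableSpace Ω] {μ : Measure Ω} (X : BanachFunctionSpace μ) :
    Module ℝ X := inferInstanceAs (Module ℝ X.carrier)

instance {Ω : Type*} [MeasurableSpace Ω] {μ : Measure Ω} (X : BanachFunctionSpace μ) :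
    Norm X := ⟨X.norm⟩

theorem normCore {Ω : Type*} [MeasurableSpace Ω] {μ : Measure Ω} (X : BanachFunctionSpace μ) :
    NormedSpace.Core ℝ X where
  norm_nonneg f := X.norm_nonneg f
  norm_smul c f := X.norm_smul c f
  norm_triangle f g := X.norm_add_le f g
  norm_eq_zero_iff f := by
    refine ⟨X.eq_zero_of_norm_eq_zero f, ?_⟩
    rintro rfl
    have h := X.norm_smul 0 0
    rw [zero_smul, abs_zero, zero_mul] at h
    exact h

noncomputable instance {Ω : Type*} [MeasurableSpace Ω] {μ : Measure Ω} (X : BanachFunctionSpace μ) :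
    NormedAddCommGroup X := NormedAddCommGroup.ofCore X.normCore

noncomputable instance {Ω : Type*} [MeasurableSpace Ω] {μ : Measure Ω} (X : BanachFunctionSpace μ) :
    NormedSpace ℝ X := NormedSpace.ofCore X.normCore

instance {Ω : Type*} [MeasurableSpace Ω] {μ : Measure Ω} (X : BanachFunctionSpace μ) :
    CompleteSpace X := by
  refine Metric.complete_of_cauchySeq_tendsto fun u hu => ?_
  have h1 : ∀ ε > 0, ∃ N, ∀ m ≥ N, ∀ n ≥ N, ‖u m - u n‖ < ε := fun ε hε => by
    obtain ⟨N, hN⟩ := Metric.cauchySeq_iff.1 hu ε hε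
    exact ⟨N, fun m hm n hn => by rw [← dist_eq_norm]; exact hN m hm n hn⟩
  obtain ⟨f, h2⟩ : ∃ f : X, ∀ ε > 0, ∃ N, ∀ n ≥ N, ‖u n - f‖ < ε := X.complete u h1
  refine ⟨f, Metric.tendsto_atTop.2 fun ε hε => ?_⟩
  obtain ⟨N, hN⟩ := h2 ε hε
  exact ⟨N, fun n hn => by rw [dist_eq_norm]; exact hN n hn⟩

/-- The (a.e. class of the) function underlying an element of `X`. -/
def toL0 {Ω : Type*} [MeasurableSpace Ω] {μ : Measure Ω} {X : BanachFunctionSpace μ} (f : X) :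
    Ω →ₘ[μ] ℝ := f.1

/-- The order of `X` is the `μ`-a.e. order. -/
instance {Ω : Type*} [MeasurableSpace Ω] {μ : Measure Ω} (X : BanachFunctionSpace μ) :
    PartialOrder X := PartialOrder.lift (toL0 (X := X)) Subtype.val_injective

/-- The order of the dual lattice `X^*`: `φ ≤ ψ` iff `φ f ≤ ψ f` for all `f ≥ 0` in `X`. -/
instance {Ω : Type*} [MeasurableSpace Ω] {μ : Measure Ω} (X : BanachFunctionSpace μ) :
    Preorder (StrongDual ℝ X) where
  le φ ψ := ∀ f : X, 0 ≤ f → φ f ≤ ψ f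
  le_refl _ _ _ := le_rfl
  le_trans _ _ _ h₁ h₂ f hf := (h₁ f hf).trans (h₂ f hf)

/-- The a.e. class of the function `(∑ |f_i|^p)^{1/p}`. -/
noncomputable def powerSumL0 {Ω : Type*} [MeasurableSpace Ω] {μ : Measure Ω}
    {X : BanachFunctionSpace μ} (p : ℝ) {n : ℕ} (f : Fin n → X) : Ω →ₘ[μ] ℝ :=
  AEEqFun.mk (fun ω => (∑ i, |toL0 (f i) ω| ^ p) ^ (1 / p))
    (((Finset.univ.aemeasurable_fun_sum fun i _ =>
      ((toL0 (f i)).aestronglyMeasurable.aemeasurable.abs.pow_const p)).pow_const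
        (1 / p)).aestronglyMeasurable)

theorem coeFn_powerSumL0 {Ω : Type*} [MeasurableSpace Ω] {μ : Measure Ω}
    {X : BanachFunctionSpace μ} (p : ℝ) {n : ℕ} (f : Fin n → X) :
    powerSumL0 p f =ᵐ[μ] fun ω => (∑ i, |toL0 (f i) ω| ^ p) ^ (1 / p) :=
  AEEqFun.coeFn_mk _ _

theorem rpow_sum_rpow_le {p : ℝ} (hp : 1 ≤ p) {n : ℕ} (a : Fin n → ℝ) (ha : ∀ i, 0 ≤ a i) :
    (∑ i, a i ^ p) ^ (1 / p) ≤ ∑ i, a i := by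
  have hp0 : 0 < p := zero_lt_one.trans_le hp
  have hs : 0 ≤ ∑ i, a i := Finset.sum_nonneg fun i _ => ha i
  rw [one_div, Real.rpow_inv_le_iff_of_pos
    (Finset.sum_nonneg fun i _ => Real.rpow_nonneg (ha i) p) hs hp0]
  rcases hs.eq_or_lt with h | h
  · have h0 : ∀ i, a i = 0 := fun i =>
      (Finset.sum_eq_zero_iff_of_nonneg fun i _ => ha i).1 h.symm i (Finset.mem_univ i)
    simp [h0, Real.zero_rpow hp0.ne']
  · have key : ∀ i, a i ^ p ≤ a i * (∑ j, a j) ^ (p - 1) := fun i => by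
      rcases (ha i).eq_or_lt with h' | h'
      · simp [← h', Real.zero_rpow hp0.ne']
      · calc a i ^ p = a i * a i ^ (p - 1) := by
              rw [← Real.rpow_one_add' (ha i) (by linarith)]; congr 1; ring
          _ ≤ _ := by
              have h1 := Finset.single_le_sum (fun j _ => ha j) (Finset.mem_univ i)
              exact mul_le_mul_of_nonneg_left
                (Real.rpow_le_rpow (ha i) h1 (by linarith)) (ha i)
    calc ∑ i, a i ^ p ≤ ∑ i, a i * (∑ j, a j) ^ (p - 1) := Finset.sum_le_sum fun i _ => key i
      _ = (∑ j, a j) ^ p := by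
          rw [← Finset.sum_mul, ← Real.rpow_one_add' hs (by linarith)]; congr 1; ring

theorem powerSumL0_mem {Ω : Type*} [MeasurableSpace Ω] {μ : Measure Ω}
    {X : BanachFunctionSpace μ} {p : ℝ} (hp : 1 ≤ p) {n : ℕ} (f : Fin n → X) :
    powerSumL0 p f ∈ X.carrier := by
  have habs : ∀ g : X.carrier, |(g : Ω →ₘ[μ] ℝ)| ∈ X.carrier := fun g =>
    (X.solid _ g (by
      filter_upwards [AEEqFun.coeFn_abs (g : Ω →ₘ[μ] ℝ)] with ω h
      rw [h, abs_abs])).1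
  have hG : ∑ i, |toL0 (f i)| ∈ X.carrier := Submodule.sum_mem _ fun i _ => habs (f i)
  have hsum : ∀ s : Finset (Fin n), (↑(∑ i ∈ s, |toL0 (f i)|) : Ω → ℝ)
      =ᵐ[μ] fun ω => ∑ i ∈ s, |toL0 (f i) ω| := fun s => by
    induction s using Finset.induction_on with
    | empty =>
      simp only [Finset.sum_empty]
      exact AEEqFun.coeFn_zero
    | insert a s ha ih =>
      rw [Finset.sum_insert ha]
      filter_upwards [AEEqFun.coeFn_add |toL0 (f a)| (∑ i ∈ s, |toL0 (f i)|), ih,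
        AEEqFun.coeFn_abs (toL0 (f a))] with ω h1 h2 h3
      rw [h1, Pi.add_apply, h2, h3, Finset.sum_insert ha]
  refine (X.solid _ ⟨_, hG⟩ ?_).1
  filter_upwards [hsum Finset.univ, coeFn_powerSumL0 p f] with ω h1 h2
  rw [h1, h2]
  refine abs_le_abs_of_nonneg (by positivity) ?_
  exact rpow_sum_rpow_le hp _ fun i => abs_nonneg _

/-- The element `(∑ |f_i|^p)^{1/p}` of the Banach function space `X`. -/
noncomputable def powerSum {Ω : Type*} [MeasurableSpace Ω] {μ : Measure Ω}
    {X : BanachFunctionSpace μ} (p : ℝ) [hp : Fact (1 < p)] {n : ℕ} (f : Fin n → X) : X :=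
  ⟨powerSumL0 p f, powerSumL0_mem hp.out.le f⟩

/-- `X` is `p`-convex. -/
def IsPConvex {Ω : Type*} [MeasurableSpace Ω] {μ : Measure Ω} (X : BanachFunctionSpace μ)
    (p : ℝ) [Fact (1 < p)] : Prop :=
  ∃ K : ℝ, ∀ (n : ℕ) (f : Fin n → X), ‖powerSum p f‖ ≤ K * (∑ i, ‖f i‖ ^ p) ^ (1 / p)

/-- `X` is `p`-concave. -/
def IsPConcave {Ω : Type*} [MeasurableSpace Ω] {μ : Measure Ω} (X : BanachFunctionSpace μ)
    (p : ℝ) [Fact (1 < p)] : Prop :=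
  ∃ K : ℝ, ∀ (n : ℕ) (f : Fin n → X), (∑ i, ‖f i‖ ^ p) ^ (1 / p) ≤ K * ‖powerSum p f‖

/-- `ψ = (∑ |φ_i|^q)^{1/q}` in the dual Banach lattice `X^*`, where, as in every Banach lattice,
this expression means the least upper bound of the elements `∑ a_i φ_i` with `(a_i)` in the unit ball
of `ℓ^{q'}`, `1/q + 1/q' = 1`. -/
def IsDualPowerSum {Ω : Type*} [MeasurableSpace Ω] {μ : Measure Ω} {X : BanachFunctionSpace μ}
    (q : ℝ) {n : ℕ} (φ : Fin n → StrongDual ℝ X) (ψ : StrongDual ℝ X) : Prop :=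
  IsLUB {χ | ∃ a : Fin n → ℝ, ∑ i, |a i| ^ q.conjExponent ≤ 1 ∧ χ = ∑ i, a i • φ i} ψ

end BanachFunctionSpace

/-- Order continuity of the norm: `f_n ↓ 0` implies `‖f_n‖ → 0`. -/
def IsOrderContinuous (X : Type*) [NormedAddCommGroup X] [Preorder X] : Prop :=
  ∀ f : ℕ → X, Antitone f → IsGLB (Set.range f) 0 → Tendsto (fun n => ‖f n‖) atTop (𝓝 0)

/-! ### Classes of operators -/

/-- `sup_{x^* ∈ B_{E^*}} (∑ |⟨x_i, x^*⟩|^p)^{1/p}`, for `x_1, …, x_n ∈ E`. -/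
noncomputable def weakNorm {E : Type*} [NormedAddCommGroup E] [NormedSpace ℝ E]
    (p : ℝ) {n : ℕ} (x : Fin n → E) : ℝ :=
  ⨆ φ : Metric.closedBall (0 : StrongDual ℝ E) 1, (∑ i, |φ.1 (x i)| ^ p) ^ (1 / p)

/-- `sup_{y ∈ B_F} (∑ |⟨y, y_i^*⟩|^q)^{1/q}`, for `y_1^*, …, y_n^* ∈ F^*`. -/
noncomputable def weakStarNorm {F : Type*} [NormedAddCommGroup F] [NormedSpace ℝ F]
    (q : ℝ) {n : ℕ} (φ : Fin n → StrongDual ℝ F) : ℝ :=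
  ⨆ y : Metric.closedBall (0 : F) 1, (∑ i, |φ i y.1| ^ q) ^ (1 / q)

/-- The Banach space adjoint `R^* : F^* → Y^*`. -/
noncomputable def adjointOp {Y F : Type*} [NormedAddCommGroup Y] [NormedSpace ℝ Y]
    [NormedAddCommGroup F] [NormedSpace ℝ F] (R : Y →L[ℝ] F) :
    StrongDual ℝ F →L[ℝ] StrongDual ℝ Y :=
  ContinuousLinearMap.precomp ℝ R

/-- `p`-summing operators between Banach spaces. -/
def IsPSumming {E F : Type*} [NormedAddCommGroup E] [NormedSpace ℝ E]
    [NormedAddCommGroup F] [NormedSpace ℝ F] (p : ℝ) (T : E →L[ℝ] F) : Prop :=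
  ∃ K : ℝ, ∀ (n : ℕ) (x : Fin n → E), (∑ i, ‖T (x i)‖ ^ p) ^ (1 / p) ≤ K * weakNorm p x

/-- Lattice `p`-summing operators from a Banach space to a Banach function space. -/
def IsLatticePSumming {E : Type*} [NormedAddCommGroup E] [NormedSpace ℝ E]
    {Ω : Type*} [MeasurableSpace Ω] {μ : Measure Ω} {X : BanachFunctionSpace μ}
    (p : ℝ) [Fact (1 < p)] (T : E →L[ℝ] X) : Prop :=
  ∃ C : ℝ, ∀ (n : ℕ) (x : Fin n → E),
    ‖BanachFunctionSpace.powerSum p fun i => T (x i)‖ ≤ C * weakNorm p x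

/-- Lattice `q`-summing operators from a Banach space to the dual Banach lattice `Y^*` of a Banach
function space `Y`. -/
def IsDualLatticePSumming {G : Type*} [NormedAddCommGroup G] [NormedSpace ℝ G]
    {Ω : Type*} [MeasurableSpace Ω] {ν : Measure Ω} {Y : BanachFunctionSpace ν}
    (q : ℝ) (T : G →L[ℝ] StrongDual ℝ Y) : Prop :=
  ∃ C : ℝ, ∀ (n : ℕ) (x : Fin n → G), ∃ ψ : StrongDual ℝ Y,
    BanachFunctionSpace.IsDualPowerSum q (fun i => T (x i)) ψ ∧ ‖ψ‖ ≤ C * weakNorm q x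

/-- `p`-regular operators between Banach function spaces. -/
def IsPRegular {Ω₁ Ω₂ : Type*} [MeasurableSpace Ω₁] [MeasurableSpace Ω₂] {μ : Measure Ω₁}
    {ν : Measure Ω₂} {X : BanachFunctionSpace μ} {Y : BanachFunctionSpace ν}
    (p : ℝ) [Fact (1 < p)] (T : X →L[ℝ] Y) : Prop :=
  ∃ K : ℝ, ∀ (n : ℕ) (f : Fin n → X),
    ‖BanachFunctionSpace.powerSum p fun i => T (f i)‖ ≤ K * ‖BanachFunctionSpace.powerSum p f‖

/-- `p`-dominated operators; `q` is the conjugate exponent of `p`. -/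
def IsPDominated {E F : Type*} [NormedAddCommGroup E] [NormedSpace ℝ E]
    [NormedAddCommGroup F] [NormedSpace ℝ F] (p q : ℝ) (T : E →L[ℝ] F) : Prop :=
  ∃ K : ℝ, ∀ (n : ℕ) (x : Fin n → E) (φ : Fin n → StrongDual ℝ F),
    ∑ i, |φ i (T (x i))| ≤ K * weakNorm p x * weakStarNorm q φ

/-- `p`-factorable operators: `κ_F ∘ T : E → F^{**}` factors through some `L^p(μ)`, where
`κ_F : F → F^{**}` is the canonical embedding. The measure space is taken in the universe `w`. -/
def IsPFactorable {E : Type u} {F : Type v} [NormedAddCommGroup E] [NormedSpace ℝ E]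
    [NormedAddCommGroup F] [NormedSpace ℝ F] (p : ℝ) [Fact (1 < p)] (T : E →L[ℝ] F) : Prop :=
  ∃ (Ω : Type w) (_ : MeasurableSpace Ω) (μ : Measure Ω)
    (S : E →L[ℝ] Lp ℝ (ENNReal.ofReal p) μ)
    (R : Lp ℝ (ENNReal.ofReal p) μ →L[ℝ] StrongDual ℝ (StrongDual ℝ F)),
    NormedSpace.inclusionInDoubleDual ℝ F ∘L T = R ∘L S

/-! For (i) ⇒ (ii), one measure `m` does all the work. Chaining the `p`-concavity of `Y`, the
`p`-regularity of `T₀` and the `p`-convexity of `X` gives, whenever the families in `L` and the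
family `H` satisfy `∑_L |f|^p ≤ ∑_H |h|^p` a.e., that the sum over `l ∈ L` of `‖(∑_{f∈l} |T₀
f|^p)^{1/p}‖^p` is at most `C ∑_H ‖h‖^p`. A Hahn–Banach argument (`exists_separating_functional`)
puts a linear functional `ℓ` on simple functions between the two sides, and order continuity of `X`
makes `ℓ` an integral against a finite `m ≪ μ` (`exists_measure_integral_eq`). Hence `X` maps into
`L^p(m)` by the formal identity `j`, and on simple functions the power sums of `T₀` are controlled
by the `L^p(m)` norms (`exists_measure_norm_powerSum_le`).

Then `S₁ = j ∘ S₀` is `p`-summing because in `L^p` the norm of a power sum is the `ℓ^p` sum of the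
norms. The map `R₁` extends `R₀ ∘ T₀` from simple functions to `L^p(m)`. If `ψ` is the dual power
sum of the `R₀^* φ_i`, then `∑ φ_i(R₀ y_i) ≤ ψ((∑ |y_i|^p)^{1/p})` (`sum_apply_le_apply_powerSum`),
and `ℓ^p`–`ℓ^q` duality turns this into a bound for `∑ ‖R₁^* φ_i‖^q`. So `T = R₁ ∘ id ∘ S₁`.

For (ii) ⇒ (i), `L^p` itself serves as `X` and `Y`: it is `p`-convex and `p`-concave with constant 1
and all operators between such spaces are `p`-regular. The lattice summability of `R₁^*` needs the
dual power sum to exist with norm at most `(∑ ‖φ_i‖^q)^{1/q}`; it is built by a Riesz–Kantorovich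
formula (`exists_isDualPowerSum`).

Domination is Hölder's inequality together with `weakNorm_le_weakStarNorm`, and factorability is
read off from (ii). -/

namespace BanachFunctionSpace

variable {Ω : Type*} [MeasurableSpace Ω] {μ : Measure Ω} {X : BanachFunctionSpace μ}

/-! ### Elementary facts on Banach function spaces -/

theorem ext_ae {f g : X} (h : ∀ᵐ ω ∂μ, toL0 f ω = toL0 g ω) : f = g :=
  Subtype.ext (AEEqFun.ext h)

theorem toL0_add (f g : X) : toL0 (f + g) =ᵐ[μ] fun ω => toL0 f ω + toL0 g ω :=
  AEEqFun.coeFn_add (toL0 f) (toL0 g)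

theorem toL0_sub (f g : X) : toL0 (f - g) =ᵐ[μ] fun ω => toL0 f ω - toL0 g ω :=
  AEEqFun.coeFn_sub (toL0 f) (toL0 g)

theorem toL0_neg (f : X) : toL0 (-f) =ᵐ[μ] fun ω => -toL0 f ω :=
  AEEqFun.coeFn_neg (toL0 f)

theorem toL0_smul (c : ℝ) (f : X) : toL0 (c • f) =ᵐ[μ] fun ω => c * toL0 f ω :=
  AEEqFun.coeFn_smul c (toL0 f)

theorem toL0_zero : toL0 (0 : X) =ᵐ[μ] fun _ => 0 :=
  AEEqFun.coeFn_zero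

theorem toL0_sum {ι : Type*} (s : Finset ι) (f : ι → X) :
    toL0 (∑ i ∈ s, f i) =ᵐ[μ] fun ω => ∑ i ∈ s, toL0 (f i) ω := by
  classical
  induction s using Finset.induction_on with
  | empty => simpa using toL0_zero
  | insert a s ha ih =>
    rw [Finset.sum_insert ha]
    filter_upwards [toL0_add (f a) (∑ i ∈ s, f i), ih] with ω h1 h2
    rw [h1, h2, Finset.sum_insert ha]

theorem le_iff_ae {f g : X} : f ≤ g ↔ ∀ᵐ ω ∂μ, toL0 f ω ≤ toL0 g ω :=
  AEEqFun.coeFn_le.symm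

theorem nonneg_iff_ae {f : X} : 0 ≤ f ↔ ∀ᵐ ω ∂μ, 0 ≤ toL0 f ω := by
  rw [le_iff_ae]
  refine eventually_congr ?_
  filter_upwards [toL0_zero (X := X)] with ω h
  rw [h]

theorem norm_le_norm_of_ae {f g : X} (h : ∀ᵐ ω ∂μ, |toL0 f ω| ≤ |toL0 g ω|) : ‖f‖ ≤ ‖g‖ :=
  (X.solid (toL0 f) g h).2

theorem norm_le_norm_of_nonneg {f g : X} (h : ∀ᵐ ω ∂μ, |toL0 f ω| ≤ toL0 g ω) : ‖f‖ ≤ ‖g‖ :=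
  norm_le_norm_of_ae (h.mono fun _ h => h.trans (le_abs_self _))

/-- The element of `X` given by a measurable function dominated by an element of `X`. -/
theorem exists_toL0_eq {h : Ω → ℝ} (hm : AEStronglyMeasurable h μ) (g : X)
    (hg : ∀ᵐ ω ∂μ, |h ω| ≤ |toL0 g ω|) : ∃ f : X, toL0 f =ᵐ[μ] h := by
  obtain ⟨hf, -⟩ := X.solid (AEEqFun.mk h hm) g (by
    filter_upwards [AEEqFun.coeFn_mk h hm, hg] with ω h1 h2
    rw [h1]; exact h2)
  exact ⟨⟨_, hf⟩, AEEqFun.coeFn_mk h hm⟩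

theorem aestronglyMeasurable_toL0 (f : X) : AEStronglyMeasurable (toL0 f) μ :=
  (toL0 f).aestronglyMeasurable

theorem exists_abs (f : X) : ∃ g : X, toL0 g =ᵐ[μ] fun ω => |toL0 f ω| :=
  exists_toL0_eq (by simpa using (aestronglyMeasurable_toL0 f).norm) f (by simp)

theorem exists_posPart (f : X) : ∃ g : X, toL0 g =ᵐ[μ] fun ω => max (toL0 f ω) 0 :=
  exists_toL0_eq ((aestronglyMeasurable_toL0 f).sup aestronglyMeasurable_const) f
    (ae_of_all _ fun ω => by
      rcases le_total (toL0 f ω) 0 with h | h <;> simp [h])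

theorem exists_mul {h : Ω → ℝ} (hm : AEStronglyMeasurable h μ) (hh : ∀ᵐ ω ∂μ, |h ω| ≤ 1) (g : X) :
    ∃ f : X, toL0 f =ᵐ[μ] fun ω => h ω * toL0 g ω :=
  exists_toL0_eq (hm.mul (aestronglyMeasurable_toL0 g)) g (hh.mono fun ω h1 => by
    rw [abs_mul]; exact mul_le_of_le_one_left (abs_nonneg _) h1)

/-- The element of `X` given by a simple function. -/
noncomputable def ofSimple (X : BanachFunctionSpace μ) : SimpleFunc Ω ℝ →ₗ[ℝ] X where
  toFun s := ⟨AEEqFun.mk s s.aestronglyMeasurable, X.simple_mem s⟩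
  map_add' _ _ := rfl
  map_smul' _ _ := rfl

theorem toL0_ofSimple (s : SimpleFunc Ω ℝ) : toL0 (ofSimple X s) =ᵐ[μ] s :=
  AEEqFun.coeFn_mk _ _

theorem toL0_powerSum {p : ℝ} [Fact (1 < p)] {n : ℕ} (f : Fin n → X) :
    toL0 (powerSum p f) =ᵐ[μ] fun ω => (∑ i, |toL0 (f i) ω| ^ p) ^ (1 / p) :=
  coeFn_powerSumL0 p f

/-! ### Families indexed by lists -/

/-- The function `∑ |f_i|^p`. -/
noncomputable def lps (p : ℝ) (l : List X) (ω : Ω) : ℝ :=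
  (l.map fun f => |toL0 f ω| ^ p).sum

/-- `‖(∑ |f_i|^p)^{1/p}‖^p`. -/
noncomputable def lnorm (p : ℝ) [Fact (1 < p)] (l : List X) : ℝ :=
  ‖powerSum p l.get‖ ^ p

theorem lps_nonneg (p : ℝ) (l : List X) (ω : Ω) : 0 ≤ lps p l ω :=
  List.sum_nonneg (by simp only [List.mem_map]; rintro _ ⟨f, -, rfl⟩; positivity)

@[simp] theorem lps_nil (p : ℝ) (ω : Ω) : lps p ([] : List X) ω = 0 := rfl

@[simp] theorem lps_cons (p : ℝ) (f : X) (l : List X) (ω : Ω) :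
    lps p (f :: l) ω = |toL0 f ω| ^ p + lps p l ω := by simp [lps]

@[simp] theorem lps_append (p : ℝ) (l l' : List X) (ω : Ω) :
    lps p (l ++ l') ω = lps p l ω + lps p l' ω := by simp [lps]

theorem lps_smul {p : ℝ} {c : ℝ} (hc : 0 ≤ c) (l : List X) :
    ∀ᵐ ω ∂μ, lps p (l.map (c • ·)) ω = c ^ p * lps p l ω := by
  induction l with
  | nil => simp
  | cons f l ih =>
    filter_upwards [ih, toL0_smul c f] with ω h1 h2
    rw [List.map_cons, lps_cons, lps_cons, h1, h2, abs_mul, abs_of_nonneg hc,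
      Real.mul_rpow hc (abs_nonneg _), mul_add]

variable {p : ℝ} [Fact (1 < p)]

theorem exponent_pos (p : ℝ) [h : Fact (1 < p)] : 0 < p := zero_lt_one.trans h.out

theorem rpow_one_div_rpow (p : ℝ) [Fact (1 < p)] {a : ℝ} (ha : 0 ≤ a) :
    (a ^ (1 / p)) ^ p = a := by
  rw [← Real.rpow_mul ha, one_div_mul_cancel (exponent_pos p).ne', Real.rpow_one]

theorem rpow_rpow_one_div (p : ℝ) [Fact (1 < p)] {a : ℝ} (ha : 0 ≤ a) :
    (a ^ p) ^ (1 / p) = a := by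
  rw [← Real.rpow_mul ha, mul_one_div_cancel (exponent_pos p).ne', Real.rpow_one]

theorem sum_get (l : List X) (g : X → ℝ) : ∑ i, g (l.get i) = (l.map g).sum := by
  simp

theorem toL0_powerSum_get (l : List X) :
    toL0 (powerSum p l.get) =ᵐ[μ] fun ω => lps p l ω ^ (1 / p) := by
  filter_upwards [toL0_powerSum (p := p) l.get] with ω h
  rw [h, sum_get l fun f => |toL0 f ω| ^ p, lps]

theorem lnorm_nonneg (l : List X) : 0 ≤ lnorm p l := Real.rpow_nonneg (_root_.norm_nonneg _) _

theorem lnorm_mono {l l' : List X} (h : ∀ᵐ ω ∂μ, lps p l ω ≤ lps p l' ω) :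
    lnorm p l ≤ lnorm p l' := by
  refine Real.rpow_le_rpow (_root_.norm_nonneg _) (norm_le_norm_of_ae ?_) (exponent_pos p).le
  filter_upwards [h, toL0_powerSum_get (p := p) l, toL0_powerSum_get (p := p) l'] with ω h h1 h2
  have hp := exponent_pos p
  have h0 := lps_nonneg p l ω
  rw [h1, h2]
  exact abs_le_abs_of_nonneg (by positivity) (Real.rpow_le_rpow h0 h (by positivity))

theorem lnorm_smul {c : ℝ} (hc : 0 ≤ c) (l : List X) :
    lnorm p (l.map (c • ·)) = c ^ p * lnorm p l := by
  have : powerSum p (l.map (c • ·)).get = c • powerSum p l.get := by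
    refine ext_ae ?_
    filter_upwards [lps_smul hc l, toL0_powerSum_get (p := p) l,
      toL0_powerSum_get (p := p) (l.map (c • ·)), toL0_smul c (powerSum p l.get)] with ω h h1 h2 h3
    rw [h2, h3, h1, h, Real.mul_rpow (by positivity) (lps_nonneg p l ω), rpow_rpow_one_div p hc]
  rw [lnorm, lnorm, this, _root_.norm_smul, Real.norm_of_nonneg hc, Real.mul_rpow hc (_root_.norm_nonneg _)]

/-- Taking `p`-th powers makes the right-hand side additive in the family, as separation requires.
Passing to `|K|` secures a nonnegative constant. -/
theorem IsPConvex.exists_lnorm_le (h : X.IsPConvex p) :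
    ∃ K : ℝ, 0 ≤ K ∧ ∀ l : List X, lnorm p l ≤ K * (l.map fun f => ‖f‖ ^ p).sum := by
  obtain ⟨K, hK⟩ := h
  refine ⟨|K| ^ p, by positivity, fun l => ?_⟩
  have hs : 0 ≤ ∑ i, ‖l.get i‖ ^ p := Finset.sum_nonneg fun i _ => by positivity
  have h1 : ‖powerSum p l.get‖ ≤ |K| * (∑ i, ‖l.get i‖ ^ p) ^ (1 / p) :=
    (hK _ l.get).trans (mul_le_mul_of_nonneg_right (le_abs_self K) (by positivity))
  calc lnorm p l ≤ (|K| * (∑ i, ‖l.get i‖ ^ p) ^ (1 / p)) ^ p :=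
        Real.rpow_le_rpow (_root_.norm_nonneg _) h1 (exponent_pos p).le
    _ = _ := by
        rw [Real.mul_rpow (abs_nonneg _) (by positivity), rpow_one_div_rpow p hs,
          sum_get l fun f => ‖f‖ ^ p]

theorem IsPConcave.exists_le_lnorm (h : X.IsPConcave p) :
    ∃ K : ℝ, 0 ≤ K ∧ ∀ l : List X, (l.map fun f => ‖f‖ ^ p).sum ≤ K * lnorm p l := by
  obtain ⟨K, hK⟩ := h
  refine ⟨|K| ^ p, by positivity, fun l => ?_⟩
  have hs : 0 ≤ ∑ i, ‖l.get i‖ ^ p := Finset.sum_nonneg fun i _ => by positivity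
  have h1 : (∑ i, ‖l.get i‖ ^ p) ^ (1 / p) ≤ |K| * ‖powerSum p l.get‖ :=
    (hK _ l.get).trans (mul_le_mul_of_nonneg_right (le_abs_self K) (by positivity))
  calc (l.map fun f => ‖f‖ ^ p).sum = ((∑ i, ‖l.get i‖ ^ p) ^ (1 / p)) ^ p := by
        rw [rpow_one_div_rpow p hs, sum_get l fun f => ‖f‖ ^ p]
    _ ≤ (|K| * ‖powerSum p l.get‖) ^ p :=
        Real.rpow_le_rpow (by positivity) h1 (exponent_pos p).le
    _ = _ := by rw [Real.mul_rpow (abs_nonneg _) (by positivity), lnorm]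

/-- The list form of `p`-concavity for families of families. -/
theorem sum_lnorm_le {K : ℝ} (hK : ∀ l : List X, (l.map fun f => ‖f‖ ^ p).sum ≤ K * lnorm p l)
    (hK0 : 0 ≤ K) (L : List (List X)) : (L.map (lnorm p)).sum ≤ K * lnorm p L.flatten := by
  -- Concavity is applied to the power sums of the single families: the power sum of power sums is
  -- the power sum of the concatenation.
  have h1 := hK (L.map fun l => powerSum p l.get)
  rw [List.map_map] at h1
  refine h1.trans (mul_le_mul_of_nonneg_left (lnorm_mono ?_) hK0)
  clear h1
  induction L with
  | nil => simp
  | cons l L ih =>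
    filter_upwards [ih, toL0_powerSum_get (p := p) l] with ω h h1
    have h0 := lps_nonneg p l ω
    rw [List.map_cons, lps_cons, List.flatten_cons, lps_append, h1, abs_of_nonneg (by positivity),
      rpow_one_div_rpow p h0]
    gcongr

end BanachFunctionSpace

open BanachFunctionSpace in
theorem IsPRegular.exists_lnorm_le {Ω₁ Ω₂ : Type*} [MeasurableSpace Ω₁] [MeasurableSpace Ω₂]
    {μ : Measure Ω₁} {ν : Measure Ω₂} {X : BanachFunctionSpace μ} {Y : BanachFunctionSpace ν}
    {p : ℝ} [Fact (1 < p)] {T : X →L[ℝ] Y} (h : IsPRegular p T) :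
    ∃ K : ℝ, 0 ≤ K ∧ ∀ l : List X, lnorm p (l.map T) ≤ K * lnorm p l := by
  obtain ⟨K, hK⟩ := h
  refine ⟨|K| ^ p, by positivity, fun l => ?_⟩
  have h1 : ‖powerSum p fun i => T (l.get i)‖ ≤ |K| * ‖powerSum p l.get‖ :=
    (hK _ l.get).trans (mul_le_mul_of_nonneg_right (le_abs_self K) (by positivity))
  have h2 : powerSum p (l.map T).get = powerSum p fun i => T (l.get i) := by
    refine ext_ae ?_
    filter_upwards [toL0_powerSum_get (p := p) (l.map T),
      toL0_powerSum (p := p) fun i => T (l.get i)] with ω h1 h2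
    rw [h1, h2, sum_get l fun f => |toL0 (T f) ω| ^ p, lps, List.map_map]
    rfl
  calc lnorm p (l.map T) ≤ (|K| * ‖powerSum p l.get‖) ^ p := by
        rw [lnorm, h2]
        exact Real.rpow_le_rpow (by positivity) h1 (exponent_pos p).le
    _ = _ := by rw [Real.mul_rpow (abs_nonneg _) (by positivity), lnorm]

namespace BanachFunctionSpace

variable {Ω : Type*} [MeasurableSpace Ω] {μ : Measure Ω} {X : BanachFunctionSpace μ}
  {p : ℝ} [Fact (1 < p)]

/-! ### The functional separating a concave from a convex expression -/

/-- The cone of pairs `(v, t)` on which `ℓ v + t` has to be nonnegative, for a functional `ℓ` with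
`N l ≤ ℓ (∑ |f_i|^p)` and `ℓ (|h|^p) ≤ C ‖h‖^p`. -/
def separationCone (X : BanachFunctionSpace μ) (p : ℝ) [Fact (1 < p)] (N : List X → ℝ)
    (hN : ∀ (c : ℝ) (l : List X), 0 ≤ c → N (l.map (c • ·)) = c ^ p * N l) (C : ℝ) :
    PointedCone ℝ (SimpleFunc Ω ℝ × ℝ) where
  carrier := {z | ∃ (L : List (List X)) (H : List X),
    (∀ᵐ ω ∂μ, lps p L.flatten ω ≤ z.1 ω + lps p H ω) ∧
      C * (H.map fun h => ‖h‖ ^ p).sum - (L.map N).sum ≤ z.2}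
  add_mem' := by
    rintro ⟨v, t⟩ ⟨v', t'⟩ ⟨L, H, h1, h2⟩ ⟨L', H', h1', h2'⟩
    -- Addition in the cone is concatenation of families, so no convexity of `N` is needed.
    refine ⟨L ++ L', H ++ H', ?_, ?_⟩
    · filter_upwards [h1, h1'] with ω h h'
      simp only [List.flatten_append, lps_append, Prod.mk_add_mk, SimpleFunc.coe_add, Pi.add_apply]
      linarith
    · simp only [List.map_append, List.sum_append, Prod.mk_add_mk]
      linarith
  zero_mem' := ⟨[], [], by simp, by simp⟩
  smul_mem' := by
    rintro ⟨c, hc⟩ ⟨v, t⟩ ⟨L, H, h1, h2⟩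
    -- Multiplying the members of the families by `c^{1/p}` multiplies all `p`-th powers, and `N`,
    -- by `c`.
    set d : ℝ := c ^ (1 / p) with hd
    have hd0 : 0 ≤ d := by positivity
    have hdp : d ^ p = c := rpow_one_div_rpow p hc
    refine ⟨L.map (List.map (d • ·)), H.map (d • ·), ?_, ?_⟩
    · rw [← List.map_flatten]
      filter_upwards [h1, lps_smul hd0 L.flatten, lps_smul hd0 H] with ω h e1 e2
      rw [e1, e2, hdp]
      have : c * lps p L.flatten ω ≤ c * (v ω + lps p H ω) := mul_le_mul_of_nonneg_left h hc
      change _ ≤ c * v ω + _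
      linarith
    · have e1 : ((H.map (d • ·)).map fun h => ‖h‖ ^ p).sum
          = c * (H.map fun h => ‖h‖ ^ p).sum := by
        rw [List.map_map, ← List.sum_map_mul_left]
        congr 1
        refine List.map_congr_left fun h _ => ?_
        simp only [Function.comp_apply]
        rw [_root_.norm_smul, Real.norm_of_nonneg hd0, Real.mul_rpow hd0 (_root_.norm_nonneg _), hdp]
      have e2 : ((L.map (List.map (d • ·))).map N).sum = c * (L.map N).sum := by
        rw [List.map_map, ← List.sum_map_mul_left]
        congr 1
        refine List.map_congr_left fun l _ => ?_
        simp only [Function.comp_apply]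
        rw [hN d l hd0, hdp]
      rw [e1, e2]
      have : c * (C * (H.map fun h => ‖h‖ ^ p).sum - (L.map N).sum) ≤ c * t :=
        mul_le_mul_of_nonneg_left h2 hc
      change _ ≤ c * t
      linarith

/-- M. Riesz's extension theorem applied to the functional `(0, t) ↦ t`. It is nonnegative on the
cone exactly because of `hC`. The two conclusions are nonnegativity of the extension at `(s, -N l)`,
with `L = [l]` and `H` empty, and at `(-s, C ‖h‖^p)`, with `L` empty and `H = [h]`. -/
theorem exists_separating_functional (N : List X → ℝ)
    (hN : ∀ (c : ℝ) (l : List X), 0 ≤ c → N (l.map (c • ·)) = c ^ p * N l) (C : ℝ)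
    (hC : ∀ (L : List (List X)) (H : List X), (∀ᵐ ω ∂μ, lps p L.flatten ω ≤ lps p H ω) →
      (L.map N).sum ≤ C * (H.map fun h => ‖h‖ ^ p).sum) :
    ∃ ℓ : SimpleFunc Ω ℝ →ₗ[ℝ] ℝ,
      (∀ (s : SimpleFunc Ω ℝ) (l : List X), (∀ᵐ ω ∂μ, lps p l ω ≤ s ω) → N l ≤ ℓ s) ∧
      ∀ (s : SimpleFunc Ω ℝ) (h : X), (∀ᵐ ω ∂μ, s ω ≤ |toL0 h ω| ^ p) → ℓ s ≤ C * ‖h‖ ^ p := by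
  have h01 : ((0, 1) : SimpleFunc Ω ℝ × ℝ) ≠ 0 := by simp
  obtain ⟨g, hg1, hg2⟩ := riesz_extension (separationCone X p N hN C)
    (LinearPMap.mkSpanSingleton (0, 1) (1 : ℝ) h01) (by
      rintro ⟨x, hx⟩ hxS
      obtain ⟨c, rfl⟩ := Submodule.mem_span_singleton.1 hx
      obtain ⟨L, H, h1, h2⟩ := hxS
      have h3 := hC L H (by simpa using h1)
      have h4 : C * (H.map fun h => ‖h‖ ^ p).sum - (L.map N).sum ≤ c := by simpa using h2
      rw [LinearPMap.mkSpanSingleton'_apply]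
      simp only [RingHom.id_apply, smul_eq_mul, mul_one]
      linarith) (by
      rintro ⟨v, t⟩
      -- Simple functions are bounded and constants lie in `X`, so the constant `M^{1/p}` can play
      -- the role of `h` and every `(v, t)` enters the cone after its second entry is shifted.
      obtain ⟨M, hM⟩ : ∃ M : ℝ, 0 ≤ M ∧ ∀ ω, -v ω ≤ M := by
        obtain ⟨M, hM⟩ := SimpleFunc.exists_forall_norm_le v
        exact ⟨|M|, abs_nonneg _, fun ω => (neg_le_abs _).trans ((hM ω).trans (le_abs_self M))⟩
      let h : X := ofSimple X (SimpleFunc.const Ω (M ^ (1 / p)))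
      refine ⟨⟨(C * ‖h‖ ^ p - t) • (0, 1), Submodule.mem_span_singleton.2 ⟨_, rfl⟩⟩, [], [h], ?_, ?_⟩
      · filter_upwards [toL0_ofSimple (X := X) (SimpleFunc.const Ω (M ^ (1 / p)))] with ω h1
        have : |toL0 h ω| ^ p = M := by
          rw [show toL0 h ω = M ^ (1 / p) from h1,
            abs_of_nonneg (Real.rpow_nonneg hM.1 _), rpow_one_div_rpow p hM.1]
        have h2 := hM.2 ω
        simp [this]
        linarith
      · simp)
  have hg3 : ∀ v t, g (v, t) = g (v, 0) + t := fun v t => by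
    have h1 : g (0, 1) = 1 := by
      have := hg1 ⟨(0, 1), Submodule.mem_span_singleton_self _⟩
      rw [this]
      exact LinearPMap.mkSpanSingleton_apply ℝ ℝ h01 1
    have h2 : ((v, t) : SimpleFunc Ω ℝ × ℝ) = (v, 0) + t • (0, 1) := by simp
    rw [h2, map_add, map_smul, h1, smul_eq_mul, mul_one]
  refine ⟨g ∘ₗ LinearMap.inl ℝ _ _, fun s l h => ?_, fun s h hs => ?_⟩
  · have := hg2 (s, -N l) ⟨[l], [], by simpa using h, by simp⟩
    rw [hg3] at this
    simp only [LinearMap.comp_apply, LinearMap.inl_apply]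
    linarith
  · have := hg2 (-s, C * ‖h‖ ^ p) ⟨[], [h], by
      filter_upwards [hs] with ω h
      simpa using h, by simp⟩
    rw [hg3] at this
    have h2 : g (-s, 0) = - g (s, 0) := by
      rw [← map_neg]; simp
    simp only [LinearMap.comp_apply, LinearMap.inl_apply]
    linarith

end BanachFunctionSpace

/-! ### Simple functions -/

/-- The indicator function of a measurable set, as a simple function. -/
noncomputable def indSimple {Ω : Type*} [MeasurableSpace Ω] (A : Set Ω) (hA : MeasurableSet A) :
    SimpleFunc Ω ℝ :=
  SimpleFunc.piecewise A hA (SimpleFunc.const Ω 1) (SimpleFunc.const Ω 0)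

theorem indSimple_apply {Ω : Type*} [MeasurableSpace Ω] {A : Set Ω} (hA : MeasurableSet A) (ω : Ω) :
    indSimple A hA ω = A.indicator 1 ω := by
  classical
  simp [indSimple, Set.indicator, Set.piecewise]

theorem indSimple_nonneg {Ω : Type*} [MeasurableSpace Ω] {A : Set Ω} (hA : MeasurableSet A) (ω : Ω) :
    0 ≤ indSimple A hA ω := by
  rw [indSimple_apply]
  exact Set.indicator_nonneg (fun _ _ => zero_le_one) ω

/-- Round `h` down to a multiple of `ε`; boundedness leaves finitely many values. -/
theorem exists_simpleFunc_abs_sub_le {Ω : Type*} [MeasurableSpace Ω] {h : Ω → ℝ}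
    (hm : Measurable h) {M : ℝ} (hM : ∀ ω, |h ω| ≤ M) {ε : ℝ} (hε : 0 < ε) :
    ∃ s : SimpleFunc Ω ℝ, ∀ ω, |h ω - s ω| ≤ ε := by
  have hk : Measurable fun ω => ⌊h ω / ε⌋ := (hm.div_const ε).floor
  have hfin : (Set.range fun ω => ⌊h ω / ε⌋).Finite := by
    refine (Set.finite_Icc ⌊-M / ε⌋ ⌊M / ε⌋).subset ?_
    rintro _ ⟨ω, rfl⟩
    have := abs_le.1 (hM ω)
    exact ⟨Int.floor_le_floor (by gcongr; exact this.1), Int.floor_le_floor (by gcongr; exact this.2)⟩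
  let k : SimpleFunc Ω ℤ := ⟨fun ω => ⌊h ω / ε⌋, fun n => hk (measurableSet_singleton n),
    hfin⟩
  refine ⟨SimpleFunc.map (fun n : ℤ => (n : ℝ) * ε) k, fun ω => ?_⟩
  have h1 := Int.floor_le (h ω / ε)
  have h2 := (Int.lt_floor_add_one (h ω / ε)).le
  rw [le_div_iff₀ hε] at h1
  rw [div_le_iff₀ hε] at h2
  change |h ω - (⌊h ω / ε⌋ : ℝ) * ε| ≤ ε
  rw [abs_le]
  constructor <;> linarith

/-! ### Order continuity: density of simple functions and integral representation -/

namespace BanachFunctionSpace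

variable {Ω : Type*} [MeasurableSpace Ω] {μ : Measure Ω} {X : BanachFunctionSpace μ}
  {p : ℝ} [Fact (1 < p)]

theorem tendsto_norm_of_antitone (hX : IsOrderContinuous X) {f : ℕ → X} (hf : Antitone f)
    (h0 : ∀ᵐ ω ∂μ, Tendsto (fun n => toL0 (f n) ω) atTop (𝓝 0)) :
    Tendsto (fun n => ‖f n‖) atTop (𝓝 0) := by
  have ha : ∀ᵐ ω ∂μ, Antitone fun n => toL0 (f n) ω := by
    have : ∀ᵐ ω ∂μ, ∀ n, toL0 (f (n + 1)) ω ≤ toL0 (f n) ω :=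
      ae_all_iff.2 fun n => le_iff_ae.1 (hf n.le_succ)
    exact this.mono fun ω h => antitone_nat_of_succ_le h
  refine hX f hf ⟨?_, fun g hg => ?_⟩
  · rintro _ ⟨n, rfl⟩
    rw [nonneg_iff_ae]
    filter_upwards [h0, ha] with ω h1 h2
    exact h2.le_of_tendsto h1 n
  · have hg' : ∀ᵐ ω ∂μ, ∀ n, toL0 g ω ≤ toL0 (f n) ω :=
      ae_all_iff.2 fun n => le_iff_ae.1 (hg ⟨n, rfl⟩)
    rw [le_iff_ae]
    filter_upwards [h0, hg', toL0_zero (X := X)] with ω h1 h2 h3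
    rw [h3]
    exact ge_of_tendsto' h1 h2

theorem norm_le_of_abs_le_const {f : X} {c : ℝ} (hc : 0 ≤ c)
    (h : ∀ᵐ ω ∂μ, |toL0 f ω| ≤ c) : ‖f‖ ≤ c * ‖ofSimple X (SimpleFunc.const Ω 1)‖ := by
  have h1 : ‖f‖ ≤ ‖c • ofSimple X (SimpleFunc.const Ω 1)‖ := by
    refine norm_le_norm_of_nonneg ?_
    filter_upwards [h, toL0_smul c (ofSimple X (SimpleFunc.const Ω 1)),
      toL0_ofSimple (X := X) (SimpleFunc.const Ω 1)] with ω h h2 h3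
    rw [h2, h3]
    simpa using h
  rwa [_root_.norm_smul, Real.norm_of_nonneg hc] at h1

/-- The part of `f` where `|f| > n` tends to 0 in norm by order continuity, and the remaining
bounded part is uniformly approximable, which suffices since constants lie in `X`. -/
theorem denseRange_ofSimple (hX : IsOrderContinuous X) : DenseRange (ofSimple X) := by
  intro f
  rw [Metric.mem_closure_iff]
  intro ε hε
  have hm : Measurable (toL0 f) := (toL0 f).measurable
  have hmeas : ∀ n : ℕ, MeasurableSet {ω | (n : ℝ) < |toL0 f ω|} := fun n =>
    measurableSet_lt measurable_const hm.abs
  have habs : ∀ n : ℕ, ∃ g : X,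
      toL0 g =ᵐ[μ] {ω | (n : ℝ) < |toL0 f ω|}.indicator fun ω => |toL0 f ω| := fun n =>
    exists_toL0_eq ((hm.abs.indicator (hmeas n)).aestronglyMeasurable) f (ae_of_all _ fun ω => by
      by_cases h : ω ∈ {ω | (n : ℝ) < |toL0 f ω|} <;> simp [h])
  choose g hg using habs
  have hg0 : Tendsto (fun n => ‖g n‖) atTop (𝓝 0) := by
    refine tendsto_norm_of_antitone hX (antitone_nat_of_succ_le fun n => ?_) ?_
    · rw [le_iff_ae]
      filter_upwards [hg n, hg (n + 1)] with ω h1 h2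
      rw [h1, h2]
      refine Set.indicator_le_indicator_of_subset (fun ω hω => ?_) (fun ω => abs_nonneg _) ω
      simp only [Set.mem_ofPred_eq, Nat.cast_add, Nat.cast_one] at hω ⊢
      linarith
    · filter_upwards [ae_all_iff.2 hg] with ω h
      refine tendsto_const_nhds.congr' ?_
      obtain ⟨N, hN⟩ := exists_nat_ge |toL0 f ω|
      filter_upwards [eventually_ge_atTop N] with n hn
      rw [h n, Set.indicator_of_notMem]
      have : (N : ℝ) ≤ n := by exact_mod_cast hn
      simp only [Set.mem_ofPred_eq, not_lt]
      linarith
  obtain ⟨n, hn⟩ := ((tendsto_order.1 hg0).2 (ε / 2) (half_pos hε)).exists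
  set c := ‖ofSimple X (SimpleFunc.const Ω 1)‖ with hc
  have hc0 : 0 ≤ c := _root_.norm_nonneg _
  -- A uniform error `η` costs at most `η c` in norm; dividing by `c + 1` rather than `c` covers the
  -- case `c = 0`.
  obtain ⟨s, hs⟩ := exists_simpleFunc_abs_sub_le
    (h := {ω | (n : ℝ) < |toL0 f ω|}ᶜ.indicator (toL0 f)) (hm.indicator (hmeas n).compl) (M := n)
    (fun ω => by
      by_cases h : (n : ℝ) < |toL0 f ω|
      · simp [h]
      · rw [Set.indicator_of_mem (by simpa using h)]
        exact not_lt.1 h) (ε := ε / 2 / (c + 1)) (by positivity)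
  refine ⟨_, ⟨s, rfl⟩, ?_⟩
  rw [dist_eq_norm]
  obtain ⟨b, hb⟩ : ∃ b : X, toL0 b =ᵐ[μ] {ω | (n : ℝ) < |toL0 f ω|}.indicator (toL0 f) :=
    exists_toL0_eq ((hm.indicator (hmeas n)).aestronglyMeasurable) f (ae_of_all _ fun ω => by
      by_cases h : ω ∈ {ω | (n : ℝ) < |toL0 f ω|} <;> simp [h])
  have h1 : ‖b‖ ≤ ‖g n‖ := norm_le_norm_of_nonneg (by
    filter_upwards [hb, hg n] with ω h1 h2
    rw [h1, h2]
    by_cases h : ω ∈ {ω | (n : ℝ) < |toL0 f ω|} <;> simp [h])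
  have h2 : ‖f - ofSimple X s - b‖ ≤ ε / 2 / (c + 1) * c := norm_le_of_abs_le_const (by positivity) (by
    filter_upwards [hb, toL0_sub (f - ofSimple X s) b, toL0_sub f (ofSimple X s),
      toL0_ofSimple (X := X) s] with ω h1 h2 h3 h4
    rw [h2, h3, h4, h1]
    convert! hs ω using 2
    by_cases h : ω ∈ {ω | (n : ℝ) < |toL0 f ω|}
    · rw [Set.indicator_of_mem h, Set.indicator_of_notMem (by simpa using h)]; ring
    · rw [Set.indicator_of_notMem h, Set.indicator_of_mem (by simpa using h)]; ring)
  have h3 : ε / 2 / (c + 1) * c ≤ ε / 2 := by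
    rw [div_mul_eq_mul_div, div_le_iff₀ (by positivity)]
    nlinarith
  calc ‖f - ofSimple X s‖ = ‖(f - ofSimple X s - b) + b‖ := by rw [sub_add_cancel]
    _ ≤ _ := _root_.norm_add_le _ _
    _ < ε := by linarith

/-- A positive functional on the simple functions which is dominated by the `p`-th power of an order
continuous norm is the integral with respect to a finite measure. -/
theorem exists_measure_integral_eq (hX : IsOrderContinuous X) (ℓ : SimpleFunc Ω ℝ →ₗ[ℝ] ℝ)
    (hpos : ∀ s : SimpleFunc Ω ℝ, (∀ᵐ ω ∂μ, 0 ≤ s ω) → 0 ≤ ℓ s) {C : ℝ}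
    (hC : ∀ (s : SimpleFunc Ω ℝ) (h : X), (∀ᵐ ω ∂μ, s ω ≤ |toL0 h ω| ^ p) → ℓ s ≤ C * ‖h‖ ^ p) :
    ∃ m : Measure Ω, IsFiniteMeasure m ∧ m ≪ μ ∧ ∀ s : SimpleFunc Ω ℝ, ∫ ω, s ω ∂m = ℓ s := by
  have hp := exponent_pos p
  have hind : ∀ {A : Set Ω} (hA : MeasurableSet A),
      ℓ (indSimple A hA) ≤ C * ‖ofSimple X (indSimple A hA)‖ ^ p := fun {A} hA => by
    refine hC _ _ ?_
    filter_upwards [toL0_ofSimple (X := X) (indSimple A hA)] with ω h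
    rw [h, indSimple_apply]
    by_cases h : ω ∈ A <;> simp [h, Real.zero_rpow hp.ne']
  have hind0 : ∀ {A : Set Ω} (hA : MeasurableSet A), 0 ≤ ℓ (indSimple A hA) := fun hA =>
    hpos _ (ae_of_all _ fun ω => indSimple_nonneg hA ω)
  have hempty : ℓ (indSimple ∅ MeasurableSet.empty) = 0 := by
    have : indSimple (∅ : Set Ω) MeasurableSet.empty = 0 := by
      ext ω; rw [indSimple_apply]; simp
    rw [this, map_zero]
  have hsum : ∀ ⦃A : ℕ → Set Ω⦄ (hA : ∀ i, MeasurableSet (A i)), Pairwise (Function.onFun Disjoint A) →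
      HasSum (fun i => ℓ (indSimple (A i) (hA i))) (ℓ (indSimple (⋃ i, A i) (.iUnion hA))) := by
    intro A hA hd
    rw [hasSum_iff_tendsto_nat_of_nonneg fun i => hind0 (hA i)]
    -- By disjointness the tails decrease to the empty set, so their indicators tend to 0 in the
    -- norm of `X`, and `ℓ` of them is squeezed by `C ‖·‖^p`. This is σ-additivity.
    let B : ℕ → Set Ω := fun n => ⋃ i ≥ n, A i
    have hB : ∀ n, MeasurableSet (B n) := fun n => .iUnion fun i => .iUnion fun _ => hA i
    have hstep : ∀ n, indSimple (B n) (hB n)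
        = indSimple (A n) (hA n) + indSimple (B (n + 1)) (hB (n + 1)) := fun n => by
      ext ω
      rw [SimpleFunc.add_apply, indSimple_apply, indSimple_apply, indSimple_apply]
      have hBn : ω ∈ B n ↔ ω ∈ A n ∨ ω ∈ B (n + 1) := by
        simp only [B, Set.mem_iUnion, exists_prop]
        constructor
        · rintro ⟨i, hi, h⟩
          rcases hi.eq_or_lt with rfl | hi
          · exact Or.inl h
          · exact Or.inr ⟨i, hi, h⟩
        · rintro (h | ⟨i, hi, h⟩)
          · exact ⟨n, le_rfl, h⟩
          · exact ⟨i, (Nat.le_succ n).trans hi, h⟩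
      by_cases h1 : ω ∈ A n
      · have h2 : ω ∉ B (n + 1) := by
          simp only [B, Set.mem_iUnion, exists_prop, not_exists, not_and]
          intro i hi h
          exact Set.disjoint_left.1 (hd (show n ≠ i by have : n + 1 ≤ i := hi; omega)) h1 h
        simp [hBn, h1, h2]
      · by_cases h2 : ω ∈ B (n + 1) <;> simp [hBn, h1, h2]
    have hpart : ∀ n, ∑ i ∈ Finset.range n, ℓ (indSimple (A i) (hA i))
        = ℓ (indSimple (⋃ i, A i) (.iUnion hA)) - ℓ (indSimple (B n) (hB n)) := fun n => by
      induction n with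
      | zero =>
        have : indSimple (B 0) (hB 0) = indSimple (⋃ i, A i) (.iUnion hA) := by
          ext ω; rw [indSimple_apply, indSimple_apply]; simp [B]
        rw [this]; simp
      | succ n ih =>
        rw [Finset.sum_range_succ, ih, hstep n, map_add]; ring
    have hnorm : Tendsto (fun n => ‖ofSimple X (indSimple (B n) (hB n))‖) atTop (𝓝 0) := by
      refine tendsto_norm_of_antitone hX (antitone_nat_of_succ_le fun n => ?_) ?_
      · rw [le_iff_ae]
        filter_upwards [toL0_ofSimple (X := X) (indSimple (B n) (hB n)),
          toL0_ofSimple (X := X) (indSimple (B (n + 1)) (hB (n + 1)))] with ω h1 h2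
        rw [h1, h2, hstep n, SimpleFunc.add_apply]
        have := indSimple_nonneg (hA n) ω
        linarith
      · filter_upwards [ae_all_iff.2 fun n => toL0_ofSimple (X := X) (indSimple (B n) (hB n))]
          with ω h
        refine tendsto_const_nhds.congr' ?_
        by_cases hω : ∃ i, ω ∈ A i
        · obtain ⟨i, hi⟩ := hω
          filter_upwards [eventually_gt_atTop i] with n hn
          rw [h n, indSimple_apply, Set.indicator_of_notMem]
          simp only [B, Set.mem_iUnion, exists_prop, not_exists, not_and]
          intro j hj h
          exact Set.disjoint_left.1 (hd (show i ≠ j by have : n ≤ j := hj; omega)) hi h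
        · refine Eventually.of_forall fun n => ?_
          change 0 = toL0 (ofSimple X (indSimple (B n) (hB n))) ω
          rw [h n, indSimple_apply, Set.indicator_of_notMem]
          simp only [B, Set.mem_iUnion, exists_prop, not_exists, not_and]
          exact fun j _ h => hω ⟨j, h⟩
    have hlim : Tendsto (fun n => ℓ (indSimple (B n) (hB n))) atTop (𝓝 0) := by
      have h1 : Tendsto (fun n => C * ‖ofSimple X (indSimple (B n) (hB n))‖ ^ p) atTop (𝓝 0) := by
        have := (hnorm.rpow_const (Or.inr hp.le)).const_mul C
        rwa [Real.zero_rpow hp.ne', mul_zero] at this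
      exact squeeze_zero (fun n => hind0 (hB n)) (fun n => hind (hB n)) h1
    simp only [hpart]
    simpa using tendsto_const_nhds.sub hlim
  let m : Measure Ω := Measure.ofMeasurable (fun A hA => ENNReal.ofReal (ℓ (indSimple A hA)))
    (by rw [hempty, ENNReal.ofReal_zero]) (fun A hA hd => by
      rw [← (hsum hA hd).tsum_eq,
        ENNReal.ofReal_tsum_of_nonneg (fun i => hind0 (hA i)) (hsum hA hd).summable])
  have hm : ∀ {A : Set Ω} (hA : MeasurableSet A), m A = ENNReal.ofReal (ℓ (indSimple A hA)) :=
    fun {A} hA => Measure.ofMeasurable_apply A hA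
  have hfin : IsFiniteMeasure m := ⟨by rw [hm MeasurableSet.univ]; exact ENNReal.ofReal_lt_top⟩
  refine ⟨m, hfin, Measure.AbsolutelyContinuous.mk fun A hA h0 => ?_, fun s => ?_⟩
  · rw [hm hA, ENNReal.ofReal_eq_zero]
    -- The indicator of a `μ`-null set is a.e. below `|h|^p` with `h = 0`, which forces its
    -- `ℓ`-value to be at most 0.
    have := hC (indSimple A hA) 0 (by
      have h1 : ∀ᵐ ω ∂μ, ω ∉ A := measure_eq_zero_iff_ae_notMem.1 h0
      filter_upwards [h1] with ω h
      rw [indSimple_apply, Set.indicator_of_notMem h]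
      positivity)
    rwa [norm_zero, Real.zero_rpow hp.ne', mul_zero] at this
  · induction s using SimpleFunc.induction with
    | const c hA =>
      rename_i A
      have h1 : SimpleFunc.piecewise A hA (SimpleFunc.const Ω c) (SimpleFunc.const Ω 0)
          = c • indSimple A hA := by
        ext ω
        rw [SimpleFunc.smul_apply, indSimple_apply]
        by_cases h : ω ∈ A <;> simp [h]
      have h2 : ∀ ω, indSimple A hA ω = A.indicator (fun _ => (1 : ℝ)) ω := indSimple_apply hA
      rw [h1, map_smul]
      simp only [SimpleFunc.smul_apply]
      rw [integral_smul]
      simp only [h2]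
      rw [integral_indicator_const _ hA, Measure.real, hm hA, ENNReal.toReal_ofReal (hind0 hA)]
      simp
    | add hd hf hg =>
      rename_i f g
      rw [map_add, ← hf, ← hg, ← integral_add (SimpleFunc.integrable_of_isFiniteMeasure f)
        (SimpleFunc.integrable_of_isFiniteMeasure g)]
      rfl

end BanachFunctionSpace

/-! ### The norm of `L^p` -/

section Lp

variable {Ω : Type*} [MeasurableSpace Ω] {m : Measure Ω} {p : ℝ} [Fact (1 < p)]

open BanachFunctionSpace in
theorem ofReal_exponent_ne_zero (p : ℝ) [Fact (1 < p)] : ENNReal.ofReal p ≠ 0 := by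
  simpa using exponent_pos p

open BanachFunctionSpace in
theorem toReal_ofReal_exponent (p : ℝ) [Fact (1 < p)] : (ENNReal.ofReal p).toReal = p :=
  ENNReal.toReal_ofReal (exponent_pos p).le

open BanachFunctionSpace in
theorem eLpNorm_ofReal_eq (f : Ω → ℝ) : eLpNorm f (ENNReal.ofReal p) m
    = (∫⁻ ω, ENNReal.ofReal (|f ω| ^ p) ∂m) ^ (1 / p) := by
  rw [eLpNorm_eq_lintegral_rpow_enorm_toReal (ofReal_exponent_ne_zero p) ENNReal.ofReal_ne_top,
    toReal_ofReal_exponent]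
  congr 2
  ext ω
  rw [← ENNReal.ofReal_rpow_of_nonneg (abs_nonneg _) (exponent_pos p).le, Real.enorm_eq_ofReal_abs]

open BanachFunctionSpace in
theorem eLpNorm_ofReal_le {f : Ω → ℝ} {B : ℝ} (hB0 : 0 ≤ B)
    (hB : ∫⁻ ω, ENNReal.ofReal (|f ω| ^ p) ∂m ≤ ENNReal.ofReal B) :
    eLpNorm f (ENNReal.ofReal p) m ≤ ENNReal.ofReal (B ^ (1 / p)) := by
  have hp := exponent_pos p
  rw [eLpNorm_ofReal_eq, ← ENNReal.ofReal_rpow_of_nonneg hB0 (by positivity)]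
  exact ENNReal.rpow_le_rpow hB (by positivity)

theorem Lp.integrable_abs_rpow (g : Lp ℝ (ENNReal.ofReal p) m) :
    Integrable (fun ω => |g ω| ^ p) m := by
  have := (Lp.memLp g).integrable_norm_rpow (ofReal_exponent_ne_zero p) ENNReal.ofReal_ne_top
  simpa [toReal_ofReal_exponent] using this

open BanachFunctionSpace in
theorem Lp.norm_rpow_eq_integral (g : Lp ℝ (ENNReal.ofReal p) m) :
    ‖g‖ ^ p = ∫ ω, |g ω| ^ p ∂m := by
  have h0 : 0 ≤ ∫ ω, |g ω| ^ p ∂m := integral_nonneg fun ω => by positivity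
  rw [Lp.norm_def, (Lp.memLp g).eLpNorm_eq_integral_rpow_norm (ofReal_exponent_ne_zero p)
    ENNReal.ofReal_ne_top, toReal_ofReal_exponent p, ENNReal.toReal_ofReal (by positivity)]
  simp only [Real.norm_eq_abs]
  rw [← one_div, rpow_one_div_rpow p h0]

open BanachFunctionSpace in
-- Exchange of sum and integral. This identity is why, over `L^p`, lattice notions and their norm
-- counterparts coincide.
theorem Lp.sum_norm_rpow_eq {n : ℕ} (g : Fin n → Lp ℝ (ENNReal.ofReal p) m)
    (G : Lp ℝ (ENNReal.ofReal p) m) (h : ∀ᵐ ω ∂m, G ω = (∑ i, |g i ω| ^ p) ^ (1 / p)) :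
    ∑ i, ‖g i‖ ^ p = ‖G‖ ^ p := by
  simp only [Lp.norm_rpow_eq_integral]
  rw [← integral_finsetSum _ fun i _ => Lp.integrable_abs_rpow (g i)]
  refine integral_congr_ae (h.mono fun ω h => ?_)
  have h0 : 0 ≤ ∑ i, |g i ω| ^ p := Finset.sum_nonneg fun i _ => by positivity
  simp only [h]
  rw [abs_of_nonneg (by positivity), rpow_one_div_rpow p h0]

/-- The class in `L^p` of a simple function. -/
noncomputable def simpleToLp (m : Measure Ω) [IsFiniteMeasure m] (p : ℝ) [Fact (1 < p)] :
    SimpleFunc Ω ℝ →ₗ[ℝ] Lp ℝ (ENNReal.ofReal p) m where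
  toFun s := (s.memLp_of_isFiniteMeasure (ENNReal.ofReal p) m).toLp s
  map_add' _ _ := rfl
  map_smul' _ _ := rfl

theorem coeFn_simpleToLp [IsFiniteMeasure m] (s : SimpleFunc Ω ℝ) :
    simpleToLp m p s =ᵐ[m] s :=
  MemLp.coeFn_toLp (s.memLp_of_isFiniteMeasure (ENNReal.ofReal p) m)

theorem denseRange_simpleToLp [IsFiniteMeasure m] : DenseRange (simpleToLp m p) := by
  intro f
  rw [Metric.mem_closure_iff]
  intro ε hε
  obtain ⟨s, hs, hs'⟩ := (Lp.memLp f).exists_simpleFunc_eLpNorm_sub_lt ENNReal.ofReal_ne_top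
    (ENNReal.ofReal_pos.2 hε).ne'
  refine ⟨_, ⟨s, rfl⟩, ?_⟩
  rw [dist_eq_norm, Lp.norm_def]
  refine (ENNReal.toReal_lt_of_lt_ofReal ?_)
  refine lt_of_eq_of_lt (eLpNorm_congr_ae ?_) hs
  filter_upwards [Lp.coeFn_sub f (simpleToLp m p s), coeFn_simpleToLp (p := p) (m := m) s] with ω h1 h2
  rw [h1, Pi.sub_apply, Pi.sub_apply, h2]

end Lp

/-! ### The formal identity from `X` into `L^p(m)` -/

namespace BanachFunctionSpace

variable {Ω : Type*} [MeasurableSpace Ω] {μ : Measure Ω} {X : BanachFunctionSpace μ}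
  {p : ℝ} [Fact (1 < p)]

/-- The lower integral is a supremum over simple functions below `|f|^p`, and `hC` with `h = f`
bounds each of them. -/
theorem lintegral_abs_rpow_le {p : ℝ} {m : Measure Ω} [IsFiniteMeasure m] {ℓ : SimpleFunc Ω ℝ →ₗ[ℝ] ℝ}
    (hm : ∀ s : SimpleFunc Ω ℝ, ∫ ω, s ω ∂m = ℓ s) {C : ℝ}
    (hC : ∀ (s : SimpleFunc Ω ℝ) (h : X), (∀ᵐ ω ∂μ, s ω ≤ |toL0 h ω| ^ p) → ℓ s ≤ C * ‖h‖ ^ p)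
    (f : X) : ∫⁻ ω, ENNReal.ofReal (|toL0 f ω| ^ p) ∂m ≤ ENNReal.ofReal (C * ‖f‖ ^ p) := by
  rw [lintegral_eq_nnreal]
  refine iSup₂_le fun φ hφ => ?_
  let s : SimpleFunc Ω ℝ := φ.map NNReal.toReal
  have hs : ∀ ω, s ω ≤ |toL0 f ω| ^ p := fun ω => by
    have h := hφ ω
    rw [← ENNReal.ofReal_coe_nnreal, ENNReal.ofReal_le_ofReal_iff (by positivity)] at h
    exact h
  have h1 := hC s f (ae_of_all _ hs)
  rw [← hm] at h1
  refine le_trans (le_of_eq ?_) (ENNReal.ofReal_le_ofReal h1)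
  rw [ofReal_integral_eq_lintegral_ofReal (SimpleFunc.integrable_of_isFiniteMeasure s)
    (ae_of_all _ fun ω => (φ ω).2), ← SimpleFunc.lintegral_eq_lintegral]
  refine lintegral_congr fun ω => ?_
  exact (ENNReal.ofReal_coe_nnreal).symm

/-- Absolute continuity makes `j` well defined on `μ`-classes. It need not be injective, as `m` may
vanish where `μ` does not. -/
theorem exists_embedding_Lp {m : Measure Ω} (hmμ : m ≪ μ) {C : ℝ} (hC0 : 0 ≤ C)
    (hC : ∀ f : X, ∫⁻ ω, ENNReal.ofReal (|toL0 f ω| ^ p) ∂m ≤ ENNReal.ofReal (C * ‖f‖ ^ p)) :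
    ∃ j : X →L[ℝ] Lp ℝ (ENNReal.ofReal p) m, ∀ f, j f =ᵐ[m] toL0 f := by
  have hp := exponent_pos p
  have hbd : ∀ f : X, eLpNorm (toL0 f) (ENNReal.ofReal p) m ≤ ENNReal.ofReal (C ^ (1 / p) * ‖f‖) :=
    fun f => by
      refine (eLpNorm_ofReal_le (by positivity) (hC f)).trans_eq ?_
      rw [Real.mul_rpow hC0 (by positivity), rpow_rpow_one_div p (_root_.norm_nonneg _)]
  have hmem : ∀ f : X, MemLp (toL0 f) (ENNReal.ofReal p) m := fun f =>
    ⟨(aestronglyMeasurable_toL0 f).mono_ac hmμ, (hbd f).trans_lt ENNReal.ofReal_lt_top⟩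
  let j : X →ₗ[ℝ] Lp ℝ (ENNReal.ofReal p) m :=
    { toFun := fun f => (hmem f).toLp
      map_add' := fun f g => by
        rw [← MemLp.toLp_add]
        exact (MemLp.toLp_eq_toLp_iff _ _).2 (hmμ.ae_le (toL0_add f g))
      map_smul' := fun c f => by
        rw [RingHom.id_apply, ← MemLp.toLp_const_smul]
        exact (MemLp.toLp_eq_toLp_iff _ _).2 (hmμ.ae_le (toL0_smul c f)) }
  refine ⟨j.mkContinuous (C ^ (1 / p)) fun f => ?_, fun f => MemLp.coeFn_toLp (hmem f)⟩
  rw [show j f = (hmem f).toLp from rfl, Lp.norm_toLp]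
  exact ENNReal.toReal_le_of_le_ofReal (by positivity) (hbd f)

theorem isPSumming_embedding_comp {E : Type*} [NormedAddCommGroup E] [NormedSpace ℝ E]
    {m : Measure Ω} (hmμ : m ≪ μ) {j : X →L[ℝ] Lp ℝ (ENNReal.ofReal p) m}
    (hj : ∀ f, j f =ᵐ[m] toL0 f) {S : E →L[ℝ] X} (hS : IsLatticePSumming p S) :
    IsPSumming p (j ∘L S) := by
  obtain ⟨K, hK⟩ := hS
  refine ⟨‖j‖ * K, fun n x => ?_⟩
  have h1 : ∑ i, ‖(j ∘L S) (x i)‖ ^ p = ‖j (powerSum p fun i => S (x i))‖ ^ p := by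
    refine Lp.sum_norm_rpow_eq _ _ ?_
    filter_upwards [hj (powerSum p fun i => S (x i)), ae_all_iff.2 fun i => hj (S (x i)),
      hmμ.ae_le (toL0_powerSum (p := p) fun i => S (x i))] with ω h1 h2 h3
    rw [h1, h3]
    simp only [ContinuousLinearMap.comp_apply, h2]
  rw [h1, rpow_rpow_one_div p (_root_.norm_nonneg _), mul_assoc]
  exact (j.le_opNorm _).trans (mul_le_mul_of_nonneg_left (hK n x) (_root_.norm_nonneg _))

end BanachFunctionSpace

namespace BanachFunctionSpace

variable {Ω : Type*} [MeasurableSpace Ω] {μ : Measure Ω} {X : BanachFunctionSpace μ}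
  {p : ℝ} [Fact (1 < p)]

/-! ### Power sums and upper bounds in the dual -/

/-- Minkowski's inequality followed by `‖·‖_p ≤ ‖·‖_1`; it yields norm continuity of power sums. -/
theorem abs_rpow_sum_sub_le (p : ℝ) [hp : Fact (1 < p)] {n : ℕ} (a b : Fin n → ℝ) :
    |(∑ i, |a i| ^ p) ^ (1 / p) - (∑ i, |b i| ^ p) ^ (1 / p)| ≤ ∑ i, |a i - b i| := by
  have key : ∀ a b : Fin n → ℝ,
      (∑ i, |a i| ^ p) ^ (1 / p) - (∑ i, |b i| ^ p) ^ (1 / p) ≤ ∑ i, |a i - b i| := fun a b => by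
    have h1 := Real.Lp_add_le Finset.univ (fun i => a i - b i) b hp.out.le
    have h2 := rpow_sum_rpow_le hp.out.le (fun i => |a i - b i|) fun i => abs_nonneg _
    simp only [sub_add_cancel] at h1
    linarith
  rw [abs_le]
  have h1 := key a b
  have h2 := key b a
  simp only [abs_sub_comm (b _)] at h2
  constructor <;> linarith

theorem norm_powerSum_sub_le {n : ℕ} (y z : Fin n → X) :
    ‖powerSum p y - powerSum p z‖ ≤ ∑ i, ‖y i - z i‖ := by
  choose d hd using fun i => exists_abs (y i - z i)
  have h1 : ‖powerSum p y - powerSum p z‖ ≤ ‖∑ i, d i‖ := norm_le_norm_of_nonneg (by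
    filter_upwards [toL0_sub (powerSum p y) (powerSum p z), toL0_powerSum (p := p) y,
      toL0_powerSum (p := p) z, toL0_sum Finset.univ d, ae_all_iff.2 hd,
      ae_all_iff.2 fun i => toL0_sub (y i) (z i)] with ω h1 h2 h3 h4 h5 h6
    rw [h1, h2, h3, h4]
    simp only [h5, h6]
    exact abs_rpow_sum_sub_le p _ _)
  refine h1.trans ((norm_sum_le _ _).trans (Finset.sum_le_sum fun i _ => ?_))
  exact norm_le_norm_of_ae ((hd i).mono fun ω h => by rw [h, abs_abs])

theorem continuous_powerSum {n : ℕ} : Continuous (powerSum p : (Fin n → X) → X) := by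
  refine continuous_iff_continuousAt.2 fun y => ?_
  rw [ContinuousAt, tendsto_iff_norm_sub_tendsto_zero]
  refine squeeze_zero (fun _ => _root_.norm_nonneg _) (fun z => norm_powerSum_sub_le z y) ?_
  have : Continuous fun z : Fin n → X => ∑ i, ‖z i - y i‖ := by fun_prop
  simpa using this.tendsto y

theorem sum_mul_apply_le {n : ℕ} {χ : Fin n → StrongDual ℝ X} {ψ : StrongDual ℝ X}
    (hψ : ∀ a : Fin n → ℝ, ∑ i, |a i| ^ p ≤ 1 → ∑ i, a i • χ i ≤ ψ) (v : Fin n → ℝ) {f : X}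
    (hf : 0 ≤ f) : ∑ i, v i * χ i f ≤ (∑ i, |v i| ^ p) ^ (1 / p) * ψ f := by
  have hp := exponent_pos p
  set r := (∑ i, |v i| ^ p) ^ (1 / p) with hr
  have hs : 0 ≤ ∑ i, |v i| ^ p := Finset.sum_nonneg fun i _ => by positivity
  have hr0 : 0 ≤ r := by positivity
  have hrp : r ^ p = ∑ i, |v i| ^ p := rpow_one_div_rpow p hs
  rcases hr0.eq_or_lt with h | h
  · have h0 : ∀ i, v i = 0 := fun i => by
      rw [← h, Real.zero_rpow hp.ne'] at hrp
      have h1 := (Finset.sum_eq_zero_iff_of_nonneg fun i _ => by positivity).1 hrp.symm i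
        (Finset.mem_univ i)
      simpa using (Real.rpow_eq_zero (abs_nonneg _) hp.ne').1 h1
    simp [h0, ← h]
  · have h1 := hψ (fun i => v i / r) (by
      have : ∀ i, |v i / r| ^ p = |v i| ^ p / r ^ p := fun i => by
        rw [abs_div, abs_of_pos h, Real.div_rpow (abs_nonneg _) h.le]
      simp only [this]
      rw [← Finset.sum_div, ← hrp, div_self (by positivity)]) f hf
    rw [_root_.sum_apply] at h1
    simp only [_root_.smul_apply, smul_eq_mul] at h1
    calc ∑ i, v i * χ i f = r * ∑ i, v i / r * χ i f := by
          rw [Finset.mul_sum]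
          refine Finset.sum_congr rfl fun i _ => ?_
          field_simp
      _ ≤ r * ψ f := mul_le_mul_of_nonneg_left h1 h.le

/-- The vector `(s_i)` takes finitely many values `v`. With `W v` the restriction of `U` to the set
where the value is `v`, one has `z_i = ∑ v_i W_v`, and the power sum of `z` is `∑ ‖v‖_p W_v`. The
claim thus reduces to `sum_mul_apply_le` on each level set. -/
theorem sum_apply_simple_le {n : ℕ} {χ : Fin n → StrongDual ℝ X} {ψ : StrongDual ℝ X}
    (hψ : ∀ a : Fin n → ℝ, ∑ i, |a i| ^ p ≤ 1 → ∑ i, a i • χ i ≤ ψ)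
    {U : X} (hU : 0 ≤ U) (s : Fin n → SimpleFunc Ω ℝ) (z : Fin n → X)
    (hz : ∀ i, toL0 (z i) =ᵐ[μ] fun ω => s i ω * toL0 U ω) :
    ∑ i, χ i (z i) ≤ ψ (powerSum p z) := by
  classical
  let F : SimpleFunc Ω (Fin n → ℝ) :=
    { toFun := fun ω i => s i ω
      measurableSet_fiber' := fun v =>
        (measurable_pi_lambda _ fun i => (s i).measurable) (measurableSet_singleton v)
      finite_range' := (Set.Finite.pi' fun i => (s i).finite_range).subset (by
        rintro _ ⟨ω, rfl⟩ i
        exact ⟨ω, rfl⟩) }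
  have hF : ∀ ω i, F ω i = s i ω := fun _ _ => rfl
  choose W hW using fun v : Fin n → ℝ => exists_mul
    (h := (F ⁻¹' {v}).indicator 1) (μ := μ)
    ((measurable_one.indicator (F.measurableSet_fiber v)).aestronglyMeasurable)
    (ae_of_all _ fun ω => by by_cases h : ω ∈ F ⁻¹' {v} <;> simp [h]) U
  have hsum : ∀ (g : (Fin n → ℝ) → ℝ) (ω : Ω),
      ∑ v ∈ F.range, g v * ((F ⁻¹' {v}).indicator 1 ω * toL0 U ω) = g (F ω) * toL0 U ω := by
    intro g ω
    rw [Finset.sum_eq_single (F ω)]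
    · simp
    · intro v _ hv
      have : ω ∉ F ⁻¹' {v} := fun h => hv (Set.mem_singleton_iff.1 h).symm
      simp [this]
    · intro h; exact absurd (F.mem_range_self ω) h
  have hcomb : ∀ (g : (Fin n → ℝ) → ℝ), toL0 (∑ v ∈ F.range, g v • W v) =ᵐ[μ]
      fun ω => g (F ω) * toL0 U ω := fun g => by
    have h2 : ∀ᵐ ω ∂μ, ∀ v ∈ F.range, toL0 (g v • W v) ω
        = g v * ((F ⁻¹' {v}).indicator 1 ω * toL0 U ω) := by
      refine (Filter.eventually_all_finset F.range).2 fun v _ => ?_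
      filter_upwards [toL0_smul (g v) (W v), hW v] with ω h1 h2
      rw [h1, h2]
    filter_upwards [toL0_sum F.range fun v => g v • W v, h2] with ω h1 h2
    rw [h1, ← hsum g ω]
    exact Finset.sum_congr rfl h2
  have hz' : ∀ i, z i = ∑ v ∈ F.range, v i • W v := fun i => ext_ae (by
    filter_upwards [hz i, hcomb fun v => v i] with ω h1 h2
    rw [h1, h2, hF])
  have hP : powerSum p z = ∑ v ∈ F.range, ((∑ i, |v i| ^ p) ^ (1 / p)) • W v := ext_ae (by
    filter_upwards [toL0_powerSum (p := p) z, hcomb fun v => (∑ i, |v i| ^ p) ^ (1 / p),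
      ae_all_iff.2 hz, nonneg_iff_ae.1 hU] with ω h1 h2 h3 h4
    have h5 : ∀ i, |s i ω * toL0 U ω| ^ p = |s i ω| ^ p * toL0 U ω ^ p := fun i => by
      rw [abs_mul, abs_of_nonneg h4, Real.mul_rpow (abs_nonneg _) h4]
    rw [h1, h2]
    simp only [h3, h5, hF]
    rw [← Finset.sum_mul, Real.mul_rpow (Finset.sum_nonneg fun i _ => by positivity) (by positivity),
      rpow_rpow_one_div p h4])
  have hW0 : ∀ v, 0 ≤ W v := fun v => by
    rw [nonneg_iff_ae]
    filter_upwards [hW v, nonneg_iff_ae.1 hU] with ω h1 h2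
    rw [h1]
    exact mul_nonneg (Set.indicator_nonneg (fun _ _ => zero_le_one) ω) h2
  calc ∑ i, χ i (z i) = ∑ v ∈ F.range, ∑ i, v i * χ i (W v) := by
        rw [Finset.sum_comm]
        refine Finset.sum_congr rfl fun i _ => ?_
        rw [hz' i, map_sum]
        simp
    _ ≤ ∑ v ∈ F.range, (∑ i, |v i| ^ p) ^ (1 / p) * ψ (W v) :=
        Finset.sum_le_sum fun v _ => sum_mul_apply_le hψ v (hW0 v)
    _ = ψ (powerSum p z) := by rw [hP, map_sum]; simp

/-- If `ψ ≥ ∑ a_i χ_i` for all `a` in the unit ball of `ℓ^p`, then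
`∑ χ_i(y_i) ≤ ψ((∑ |y_i|^p)^{1/p})`. -/
theorem sum_apply_le_apply_powerSum {n : ℕ} {χ : Fin n → StrongDual ℝ X} {ψ : StrongDual ℝ X}
    (hψ : ∀ a : Fin n → ℝ, ∑ i, |a i| ^ p ≤ 1 → ∑ i, a i • χ i ≤ ψ) (y : Fin n → X) :
    ∑ i, χ i (y i) ≤ ψ (powerSum p y) := by
  choose d hd using fun i => exists_abs (y i)
  set U := ∑ i, d i with hUd
  have hUae : toL0 U =ᵐ[μ] fun ω => ∑ i, |toL0 (y i) ω| := by
    filter_upwards [toL0_sum Finset.univ d, ae_all_iff.2 hd] with ω h1 h2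
    rw [h1]; exact Finset.sum_congr rfl fun i _ => h2 i
  have hU : 0 ≤ U := by
    rw [nonneg_iff_ae]
    filter_upwards [hUae] with ω h
    rw [h]; positivity
  -- Approximating `y_i / U` uniformly and multiplying by `U` converges in norm in every Banach
  -- function space, without order continuity. The truncation makes the bound hold everywhere; where
  -- `U = 0` the quotient is 0 by convention and `y_i` vanishes too.
  have hc : ∀ i, Measurable fun ω => max (-1) (min 1 (toL0 (y i) ω / toL0 U ω)) := fun i =>
    measurable_const.max (measurable_const.min ((toL0 (y i)).measurable.div (toL0 U).measurable))
  have hc1 : ∀ i ω, |max (-1) (min 1 (toL0 (y i) ω / toL0 U ω))| ≤ 1 := fun i ω =>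
    abs_le.2 ⟨le_max_left _ _, max_le (by norm_num) (min_le_left _ _)⟩
  have hcy : ∀ i, ∀ᵐ ω ∂μ,
      toL0 (y i) ω = max (-1) (min 1 (toL0 (y i) ω / toL0 U ω)) * toL0 U ω := fun i => by
    filter_upwards [hUae] with ω h
    have h1 : |toL0 (y i) ω| ≤ toL0 U ω := by
      rw [h]
      exact Finset.single_le_sum (f := fun i => |toL0 (y i) ω|) (fun i _ => abs_nonneg _)
        (Finset.mem_univ i)
    rcases ((abs_nonneg _).trans h1).eq_or_lt with h0 | h0
    · rw [← h0] at h1 ⊢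
      simpa using h1
    · obtain ⟨h2, h3⟩ := abs_le.1 h1
      rw [min_eq_right ((div_le_one h0).2 h3), max_eq_right (by rw [le_div_iff₀ h0]; linarith)]
      field_simp
  have hε : ∀ ε : ℝ, 0 < ε → ∃ z : Fin n → X,
      (∀ i, ‖z i - y i‖ ≤ ε * ‖U‖) ∧ ∑ i, χ i (z i) ≤ ψ (powerSum p z) := fun ε hε => by
    choose s hs using fun i => exists_simpleFunc_abs_sub_le (hc i) (hc1 i) hε
    have hz : ∀ i, ∃ z : X, toL0 z =ᵐ[μ] fun ω => s i ω * toL0 U ω := fun i => by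
      refine exists_toL0_eq (((s i).measurable.mul (toL0 U).measurable).aestronglyMeasurable)
        ((1 + ε) • U) ?_
      filter_upwards [toL0_smul (1 + ε) U] with ω h
      rw [h, abs_mul, abs_mul]
      refine mul_le_mul_of_nonneg_right ?_ (abs_nonneg _)
      rw [abs_of_pos (by linarith : 0 < 1 + ε)]
      have h1 := abs_le.1 (hs i ω)
      have h2 := abs_le.1 (hc1 i ω)
      rw [abs_le]
      constructor <;> linarith
    choose z hz using hz
    refine ⟨z, fun i => ?_, sum_apply_simple_le hψ hU s z hz⟩
    have : ‖z i - y i‖ ≤ ‖ε • U‖ := norm_le_norm_of_nonneg (by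
      filter_upwards [toL0_sub (z i) (y i), hz i, hcy i, toL0_smul ε U, nonneg_iff_ae.1 hU]
        with ω h1 h2 h3 h4 h5
      rw [h1, h2, h4, h3, ← sub_mul, abs_mul, abs_of_nonneg h5, abs_sub_comm]
      exact mul_le_mul_of_nonneg_right (hs i ω) h5)
    rwa [_root_.norm_smul, Real.norm_of_nonneg hε.le] at this
  choose z hz1 hz2 using fun k : ℕ => hε (1 / (k + 1)) (by positivity)
  have hz : Tendsto z atTop (𝓝 y) := by
    refine tendsto_pi_nhds.2 fun i => tendsto_iff_norm_sub_tendsto_zero.2 ?_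
    refine squeeze_zero (fun _ => _root_.norm_nonneg _) (fun k => hz1 k i) ?_
    simpa using (tendsto_one_div_add_atTop_nhds_zero_nat (𝕜 := ℝ)).mul_const ‖U‖
  have hl : Continuous fun z : Fin n → X => ∑ i, χ i (z i) := by fun_prop
  exact le_of_tendsto_of_tendsto' ((hl.tendsto y).comp hz)
    (((ψ.continuous.comp continuous_powerSum).tendsto y).comp hz) hz2

end BanachFunctionSpace

/-! ### Duality between `ℓ^p` and `ℓ^q` -/

section Duality

variable {p q : ℝ}

/-- Test with `t_i = r_i^{q-1}`, for which `t_i r_i = t_i^p = r_i^q`. -/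
theorem sum_rpow_le_of_forall_sum_le (hpq : p.HolderConjugate q) {n : ℕ} {r : Fin n → ℝ}
    (hr : ∀ i, 0 ≤ r i) {M : ℝ} (hM : ∀ t : Fin n → ℝ, (∀ i, 0 ≤ t i) →
      ∑ i, t i * r i ≤ M * (∑ i, t i ^ p) ^ (1 / p)) (hM0 : 0 ≤ M) :
    (∑ i, r i ^ q) ^ (1 / q) ≤ M := by
  have hq := hpq.symm.pos
  have hs : 0 ≤ ∑ i, r i ^ q := Finset.sum_nonneg fun i _ => Real.rpow_nonneg (hr i) q
  rcases hs.eq_or_lt with h | h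
  · rw [← h, Real.zero_rpow (one_div_pos.2 hq).ne']; exact hM0
  · have h1 := hM (fun i => r i ^ (q - 1)) fun i => Real.rpow_nonneg (hr i) _
    have e1 : ∀ i, r i ^ (q - 1) * r i = r i ^ q := fun i => by
      rw [← Real.rpow_add_one' (hr i) (by linarith)]; congr 1; ring
    have e2 : ∀ i, (r i ^ (q - 1)) ^ p = r i ^ q := fun i => by
      rw [← Real.rpow_mul (hr i), hpq.symm.sub_one_mul_conj]
    simp only [e1, e2] at h1
    have e3 : (∑ i, r i ^ q) = (∑ i, r i ^ q) ^ (1 / q) * (∑ i, r i ^ q) ^ (1 / p) := by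
      rw [← Real.rpow_add h, one_div, one_div, hpq.symm.inv_add_inv_eq_one, Real.rpow_one]
    refine le_of_mul_le_mul_right (a := (∑ i, r i ^ q) ^ (1 / p)) ?_ (by positivity)
    rw [← e3]
    exact h1

/-- The norms `‖χ_i‖` need not be attained, so they are approached up to a factor `θ < 1`, and `θ →
1` at the end. -/
theorem sum_norm_rpow_le_of_forall_sum_apply_le (hpq : p.HolderConjugate q)
    {Z : Type*} [NormedAddCommGroup Z] [NormedSpace ℝ Z] {n : ℕ} (χ : Fin n → StrongDual ℝ Z)
    {M : ℝ} (hM0 : 0 ≤ M)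
    (hM : ∀ u : Fin n → Z, ∑ i, χ i (u i) ≤ M * (∑ i, ‖u i‖ ^ p) ^ (1 / p)) :
    (∑ i, ‖χ i‖ ^ q) ^ (1 / q) ≤ M := by
  have hp := hpq.pos
  have hq := hpq.symm.pos
  have key : ∀ θ ∈ Set.Ioo (0 : ℝ) 1, θ * (∑ i, ‖χ i‖ ^ q) ^ (1 / q) ≤ M := by
    rintro θ ⟨h0, h1⟩
    have hex : ∀ i, ∃ u : Z, ‖u‖ ≤ 1 ∧ θ * ‖χ i‖ ≤ χ i u := fun i => by
      rcases (norm_nonneg (χ i)).eq_or_lt with h | h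
      · exact ⟨0, by simp, by simp [← h]⟩
      · obtain ⟨u, hu, hu'⟩ := (χ i).exists_lt_apply_of_lt_opNorm
          (show θ * ‖χ i‖ < ‖χ i‖ by nlinarith)
        rcases le_total 0 (χ i u) with h2 | h2
        · exact ⟨u, hu.le, by rw [Real.norm_of_nonneg h2] at hu'; exact hu'.le⟩
        · exact ⟨-u, by rw [norm_neg]; exact hu.le,
            by rw [Real.norm_of_nonpos h2] at hu'; rw [map_neg]; exact hu'.le⟩
    choose u hu1 hu2 using hex
    have h3 := sum_rpow_le_of_forall_sum_le hpq (r := fun i => θ * ‖χ i‖)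
      (fun i => by positivity) (M := M) (fun t ht => by
        have h4 := hM fun i => t i • u i
        simp only [map_smul, smul_eq_mul] at h4
        have h5 : ∑ i, ‖t i • u i‖ ^ p ≤ ∑ i, t i ^ p := Finset.sum_le_sum fun i _ => by
          rw [norm_smul, Real.norm_of_nonneg (ht i)]
          exact Real.rpow_le_rpow (mul_nonneg (ht i) (norm_nonneg _))
            (mul_le_of_le_one_right (ht i) (hu1 i)) hp.le
        calc ∑ i, t i * (θ * ‖χ i‖) ≤ ∑ i, t i * χ i (u i) :=
              Finset.sum_le_sum fun i _ => mul_le_mul_of_nonneg_left (hu2 i) (ht i)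
          _ ≤ M * (∑ i, ‖t i • u i‖ ^ p) ^ (1 / p) := h4
          _ ≤ _ := mul_le_mul_of_nonneg_left (Real.rpow_le_rpow
              (Finset.sum_nonneg fun i _ => by positivity) h5 (by positivity)) hM0) hM0
    have h4 : ∀ i, (θ * ‖χ i‖) ^ q = θ ^ q * ‖χ i‖ ^ q := fun i =>
      Real.mul_rpow h0.le (norm_nonneg _)
    simp only [h4] at h3
    rwa [← Finset.mul_sum, Real.mul_rpow (by positivity)
      (Finset.sum_nonneg fun i _ => by positivity), ← Real.rpow_mul h0.le,
      mul_one_div_cancel hq.ne', Real.rpow_one] at h3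
  have hcont : Tendsto (fun θ : ℝ => θ * (∑ i, ‖χ i‖ ^ q) ^ (1 / q)) (𝓝[<] 1)
      (𝓝 (1 * (∑ i, ‖χ i‖ ^ q) ^ (1 / q))) :=
    (tendsto_nhdsWithin_of_tendsto_nhds tendsto_id).mul_const _
  rw [one_mul] at hcont
  refine le_of_tendsto hcont ?_
  filter_upwards [Ioo_mem_nhdsLT (zero_lt_one (α := ℝ))] with θ hθ
  exact key θ hθ

end Duality

/-! ### From lattice summing factorizations to summing factorizations through `L^p` -/

namespace BanachFunctionSpace

theorem lnorm_ofFn {Ω : Type*} [MeasurableSpace Ω] {μ : Measure Ω} {X : BanachFunctionSpace μ}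
    {p : ℝ} [Fact (1 < p)] {n : ℕ} (y : Fin n → X) :
    lnorm p (List.ofFn y) = ‖powerSum p y‖ ^ p := by
  have : powerSum p (List.ofFn y).get = powerSum p y := ext_ae (by
    filter_upwards [toL0_powerSum_get (p := p) (List.ofFn y), toL0_powerSum (p := p) y] with ω h1 h2
    rw [h1, h2, lps, List.map_ofFn, List.sum_ofFn]
    rfl)
  rw [lnorm, this]

theorem simpleFunc_sum_apply {Ω : Type*} [MeasurableSpace Ω] {n : ℕ} (s : Fin n → SimpleFunc Ω ℝ)
    (ω : Ω) : (∑ i, s i) ω = ∑ i, s i ω := by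
  have : ∀ t : Finset (Fin n), (∑ i ∈ t, s i) ω = ∑ i ∈ t, s i ω := fun t => by
    induction t using Finset.induction_on with
    | empty => simp
    | insert a t ha ih => rw [Finset.sum_insert ha, Finset.sum_insert ha, ← ih, SimpleFunc.add_apply]
  exact this _

/-- The separating functional is taken for `N l = ‖(∑ |T f|^p)^{1/p}‖^p`. Its upper bound makes `j`
bounded; its lower bound is the final inequality. -/
theorem exists_measure_norm_powerSum_le {Ω₁ Ω₂ : Type*} [MeasurableSpace Ω₁] [MeasurableSpace Ω₂]
    {μ : Measure Ω₁} {ν : Measure Ω₂} {X : BanachFunctionSpace μ} {Y : BanachFunctionSpace ν}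
    {p : ℝ} [Fact (1 < p)] (hX : X.IsPConvex p) (hoc : IsOrderContinuous X) (hY : Y.IsPConcave p)
    {T : X →L[ℝ] Y} (hT : IsPRegular p T) :
    ∃ (m : Measure Ω₁) (_ : IsFiniteMeasure m) (j : X →L[ℝ] Lp ℝ (ENNReal.ofReal p) m),
      m ≪ μ ∧ (∀ f, j f =ᵐ[m] toL0 f) ∧ (∀ s, j (ofSimple X s) = simpleToLp m p s) ∧
      ∀ (n : ℕ) (s : Fin n → SimpleFunc Ω₁ ℝ),
        ‖powerSum p fun i => T (ofSimple X (s i))‖ ≤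
          (∑ i, ‖simpleToLp m p (s i)‖ ^ p) ^ (1 / p) := by
  have hp := exponent_pos p
  obtain ⟨K₁, hK₁0, hK₁⟩ := hX.exists_lnorm_le
  obtain ⟨K₂, hK₂0, hK₂⟩ := hY.exists_le_lnorm
  obtain ⟨K₃, hK₃0, hK₃⟩ := hT.exists_lnorm_le
  obtain ⟨ℓ, hℓ1, hℓ2⟩ := exists_separating_functional (X := X) (p := p)
    (fun l => lnorm p (l.map T)) (fun c l hc => by
      rw [← lnorm_smul hc, List.map_map, List.map_map]
      congr 2
      funext f
      simp) (K₂ * (K₃ * K₁)) (fun L H h => by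
      calc (L.map fun l => lnorm p (l.map T)).sum = ((L.map (List.map T)).map (lnorm p)).sum := by
            rw [List.map_map]; rfl
        _ ≤ K₂ * lnorm p (L.map (List.map T)).flatten := sum_lnorm_le hK₂ hK₂0 _
        _ = K₂ * lnorm p (L.flatten.map T) := by rw [List.map_flatten]
        _ ≤ K₂ * (K₃ * (K₁ * (H.map fun h => ‖h‖ ^ p).sum)) := by
            gcongr
            refine (hK₃ _).trans ?_
            gcongr
            exact (lnorm_mono h).trans (hK₁ H)
        _ = _ := by ring)
  have hpos : ∀ s : SimpleFunc Ω₁ ℝ, (∀ᵐ ω ∂μ, 0 ≤ s ω) → 0 ≤ ℓ s := fun s hs => by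
    -- The lower bound for the empty family is positivity of `ℓ`.
    have := hℓ1 s [] (by simpa using hs)
    exact (lnorm_nonneg _).trans this
  obtain ⟨m, hm, hmμ, hmℓ⟩ := exists_measure_integral_eq (p := p) hoc ℓ hpos hℓ2
  obtain ⟨j, hj⟩ := exists_embedding_Lp hmμ (by positivity) (lintegral_abs_rpow_le hmℓ hℓ2)
  refine ⟨m, hm, j, hmμ, hj, fun s => ?_, fun n s => ?_⟩
  · refine Lp.ext ?_
    filter_upwards [hj (ofSimple X s), hmμ.ae_le (toL0_ofSimple (X := X) s),
      coeFn_simpleToLp (p := p) (m := m) s] with ω h1 h2 h3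
    rw [h1, h2, h3]
  · let t : SimpleFunc Ω₁ ℝ := ∑ i, (s i).map fun x => |x| ^ p
    have ht : ∀ ω, t ω = ∑ i, |s i ω| ^ p := fun ω => simpleFunc_sum_apply _ ω
    have h1 := hℓ1 t (List.ofFn fun i => ofSimple X (s i)) (by
      filter_upwards [ae_all_iff.2 fun i => toL0_ofSimple (X := X) (s i)] with ω h
      rw [ht, lps, List.map_ofFn, List.sum_ofFn]
      refine le_of_eq (Finset.sum_congr rfl fun i _ => ?_)
      simp [h])
    simp only [List.map_ofFn] at h1
    rw [lnorm_ofFn, ← hmℓ] at h1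
    have h2 : ∫ ω, t ω ∂m = ∑ i, ‖simpleToLp m p (s i)‖ ^ p := by
      simp only [Lp.norm_rpow_eq_integral]
      rw [← integral_finsetSum _ fun i _ => Lp.integrable_abs_rpow _]
      refine integral_congr_ae ?_
      filter_upwards [ae_all_iff.2 fun i => coeFn_simpleToLp (p := p) (m := m) (s i)] with ω h
      simp [ht, h]
    rw [h2] at h1
    calc ‖powerSum p fun i => T (ofSimple X (s i))‖
        = (‖powerSum p fun i => T (ofSimple X (s i))‖ ^ p) ^ (1 / p) :=
          (rpow_rpow_one_div p (_root_.norm_nonneg _)).symm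
      _ ≤ _ := Real.rpow_le_rpow (by positivity) h1 (by positivity)

theorem norm_powerSum_fin_one {Ω : Type*} [MeasurableSpace Ω] {μ : Measure Ω}
    {X : BanachFunctionSpace μ} {p : ℝ} [Fact (1 < p)] (f : X) :
    ‖powerSum p fun _ : Fin 1 => f‖ = ‖f‖ := by
  have h : ∀ᵐ ω ∂μ, |toL0 (powerSum p fun _ : Fin 1 => f) ω| = |toL0 f ω| := by
    filter_upwards [toL0_powerSum (p := p) fun _ : Fin 1 => f] with ω h
    rw [h]
    simp only [Finset.univ_unique, Finset.sum_const, Finset.card_singleton, one_smul]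
    rw [rpow_rpow_one_div p (abs_nonneg _), abs_abs]
  exact le_antisymm (norm_le_norm_of_ae (h.mono fun _ h => h.le))
    (norm_le_norm_of_ae (h.mono fun _ h => h.ge))

theorem exists_factorization_Lp {E : Type u} {F : Type v}
    [NormedAddCommGroup E] [NormedSpace ℝ E]
    [NormedAddCommGroup F] [NormedSpace ℝ F] [CompleteSpace F]
    {Ω₁ Ω₂ : Type*} [MeasurableSpace Ω₁] [MeasurableSpace Ω₂]
    {μ : Measure Ω₁} {ν : Measure Ω₂} {X : BanachFunctionSpace μ} {Y : BanachFunctionSpace ν}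
    {p q : ℝ} [Fact (1 < p)] (hpq : p.HolderConjugate q)
    (hX : X.IsPConvex p) (hoc : IsOrderContinuous X) (hY : Y.IsPConcave p)
    {S : E →L[ℝ] X} {T : X →L[ℝ] Y} {R : Y →L[ℝ] F} (hS : IsLatticePSumming p S)
    (hT : IsPRegular p T) (hR : IsDualLatticePSumming q (adjointOp R)) :
    ∃ (m : Measure Ω₁) (_ : IsFiniteMeasure m) (S₁ : E →L[ℝ] Lp ℝ (ENNReal.ofReal p) m)
      (R₁ : Lp ℝ (ENNReal.ofReal p) m →L[ℝ] F),
      IsPSumming p S₁ ∧ IsPSumming q (adjointOp R₁) ∧ R ∘L T ∘L S = R₁ ∘L S₁ := by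
  obtain ⟨m, hm, j, hmμ, hj, hjs, hN⟩ := exists_measure_norm_powerSum_le hX hoc hY hT
  have hp := exponent_pos p
  let R₀ : SimpleFunc Ω₁ ℝ →ₗ[ℝ] F := (R ∘L T).toLinearMap ∘ₗ ofSimple X
  have hbd : ∀ s, ‖R₀ s‖ ≤ ‖R‖ * ‖simpleToLp m p s‖ := fun s => by
    have h1 := hN 1 fun _ => s
    rw [norm_powerSum_fin_one] at h1
    simp only [Finset.univ_unique, Finset.sum_const, Finset.card_singleton, one_smul] at h1
    rw [rpow_rpow_one_div p (_root_.norm_nonneg _)] at h1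
    exact (R.le_opNorm _).trans (mul_le_mul_of_nonneg_left h1 (_root_.norm_nonneg _))
  have hdense : DenseRange (simpleToLp m p) := denseRange_simpleToLp
  -- The bound `hbd` also shows that `R₀` depends only on the `m`-class of the simple function.
  let R₁ : Lp ℝ (ENNReal.ofReal p) m →L[ℝ] F := R₀.extendOfNorm (simpleToLp m p)
  have hR₁ : ∀ s, R₁ (simpleToLp m p s) = R (T (ofSimple X s)) := fun s =>
    LinearMap.extendOfNorm_eq hdense ⟨_, hbd⟩ s
  refine ⟨m, hm, j ∘L S, R₁, isPSumming_embedding_comp hmμ hj hS, ?_, ?_⟩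
  · obtain ⟨C, hC⟩ := hR
    refine ⟨C, fun n φ => ?_⟩
    obtain ⟨ψ, hψ, hψC⟩ := hC n φ
    refine le_trans ?_ hψC
    refine sum_norm_rpow_le_of_forall_sum_apply_le hpq _ (_root_.norm_nonneg _) fun u => ?_
    have hd : DenseRange (Pi.map fun _ : Fin n => simpleToLp m p) := DenseRange.piMap fun _ => hdense
    refine hd.induction_on (p := fun u => ∑ i, (adjointOp R₁ (φ i)) (u i) ≤
      ‖ψ‖ * (∑ i, ‖u i‖ ^ p) ^ (1 / p)) u ?_ fun s => ?_
    · refine isClosed_le (by fun_prop) ?_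
      exact continuous_const.mul ((continuous_finsetSum _ fun i _ =>
        ((continuous_apply i).norm.rpow_const fun _ => Or.inr hp.le)).rpow_const
          fun _ => Or.inr (by positivity))
    · calc ∑ i, (adjointOp R₁ (φ i)) (simpleToLp m p (s i))
          = ∑ i, (adjointOp R (φ i)) (T (ofSimple X (s i))) :=
            Finset.sum_congr rfl fun i _ => congrArg (φ i) (hR₁ (s i))
        _ ≤ ψ (powerSum p fun i => T (ofSimple X (s i))) :=
            sum_apply_le_apply_powerSum (fun a ha => hψ.1 ⟨a, by
              rwa [hpq.symm.conjExponent_eq], rfl⟩) _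
        _ ≤ ‖ψ‖ * ‖powerSum p fun i => T (ofSimple X (s i))‖ :=
            (le_abs_self _).trans (ψ.le_opNorm _)
        _ ≤ _ := mul_le_mul_of_nonneg_left (hN n s) (_root_.norm_nonneg _)
  · have h1 : ∀ f : X, R (T f) = R₁ (j f) := fun f => by
      refine (denseRange_ofSimple hoc).induction_on (p := fun f => R (T f) = R₁ (j f)) f
        (isClosed_eq (by fun_prop) (by fun_prop)) fun s => ?_
      rw [hjs, hR₁]
    ext x
    exact h1 (S x)

end BanachFunctionSpace

/-! ### `L^p` as a Banach function space -/

/-- `L^p` as a Banach function space. -/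
noncomputable def lpSpace {Ω : Type*} [MeasurableSpace Ω] (m : Measure Ω) [IsFiniteMeasure m] (p : ℝ)
    [Fact (1 < p)] : BanachFunctionSpace m where
  carrier := Lp.LpSubmodule ℝ ℝ (ENNReal.ofReal p) m
  norm f := ‖(⟨f.1, f.2⟩ : Lp ℝ (ENNReal.ofReal p) m)‖
  norm_nonneg _ := norm_nonneg _
  norm_smul c f := norm_smul c (⟨f.1, f.2⟩ : Lp ℝ (ENNReal.ofReal p) m)
  norm_add_le f g := norm_add_le (⟨f.1, f.2⟩ : Lp ℝ (ENNReal.ofReal p) m) ⟨g.1, g.2⟩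
  eq_zero_of_norm_eq_zero f h := by
    have h1 : (⟨f.1, f.2⟩ : Lp ℝ (ENNReal.ofReal p) m) = 0 := norm_eq_zero.1 h
    exact Subtype.ext (congrArg Subtype.val h1)
  complete u hu := by
    let v : ℕ → Lp ℝ (ENNReal.ofReal p) m := fun n => ⟨(u n).1, (u n).2⟩
    have hv : CauchySeq v := Metric.cauchySeq_iff.2 fun ε hε => by
      obtain ⟨N, hN⟩ := hu ε hε
      exact ⟨N, fun m hm n hn => by rw [dist_eq_norm]; exact hN m hm n hn⟩
    obtain ⟨f, hf⟩ := cauchySeq_tendsto_of_complete hv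
    refine ⟨⟨f.1, f.2⟩, fun ε hε => ?_⟩
    obtain ⟨N, hN⟩ := Metric.tendsto_atTop.1 hf ε hε
    exact ⟨N, fun n hn => by have := hN n hn; rw [dist_eq_norm] at this; exact this⟩
  simple_mem s := (simpleToLp m p s).2
  solid f g h := by
    have hf : f ∈ Lp ℝ (ENNReal.ofReal p) m :=
      Lp.mem_Lp_of_ae_le (g := (⟨g.1, g.2⟩ : Lp ℝ (ENNReal.ofReal p) m)) h
    exact ⟨hf, Lp.norm_le_norm_of_ae_le (f := (⟨f, hf⟩ : Lp ℝ (ENNReal.ofReal p) m))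
      (g := ⟨g.1, g.2⟩) h⟩

namespace lpSpace

open BanachFunctionSpace

variable {Ω : Type*} [MeasurableSpace Ω] {m : Measure Ω} [IsFiniteMeasure m] {p : ℝ} [Fact (1 < p)]

/-- The canonical isometry of the Banach function space `L^p` and the space `Lp`. -/
noncomputable def equiv (m : Measure Ω) [IsFiniteMeasure m] (p : ℝ) [Fact (1 < p)] :
    lpSpace m p ≃ₗᵢ[ℝ] Lp ℝ (ENNReal.ofReal p) m where
  toFun f := ⟨f.1, f.2⟩
  invFun f := ⟨f.1, f.2⟩
  map_add' _ _ := rfl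
  map_smul' _ _ := rfl
  left_inv _ := rfl
  right_inv _ := rfl
  norm_map' _ := rfl

theorem integrable_abs_rpow (f : lpSpace m p) : Integrable (fun ω => |toL0 f ω| ^ p) m :=
  Lp.integrable_abs_rpow (equiv m p f)

theorem norm_rpow_eq_integral (f : lpSpace m p) : ‖f‖ ^ p = ∫ ω, |toL0 f ω| ^ p ∂m :=
  Lp.norm_rpow_eq_integral (equiv m p f)

theorem sum_norm_rpow_eq {n : ℕ} (f : Fin n → lpSpace m p) :
    ∑ i, ‖f i‖ ^ p = ‖powerSum p f‖ ^ p :=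
  Lp.sum_norm_rpow_eq (fun i => equiv m p (f i)) (equiv m p (powerSum p f))
    (toL0_powerSum (p := p) f)

theorem norm_powerSum {n : ℕ} (f : Fin n → lpSpace m p) :
    ‖powerSum p f‖ = (∑ i, ‖f i‖ ^ p) ^ (1 / p) := by
  rw [sum_norm_rpow_eq, rpow_rpow_one_div p (_root_.norm_nonneg _)]

theorem isPConvex : (lpSpace m p).IsPConvex p :=
  ⟨1, fun _ f => by rw [one_mul, norm_powerSum]⟩

theorem isPConcave : (lpSpace m p).IsPConcave p :=
  ⟨1, fun _ f => by rw [one_mul, norm_powerSum]⟩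

theorem isPRegular {Ω' : Type*} [MeasurableSpace Ω'] {m' : Measure Ω'} [IsFiniteMeasure m']
    (T : lpSpace m p →L[ℝ] lpSpace m' p) : IsPRegular p T := by
  refine ⟨‖T‖, fun n f => ?_⟩
  have hp := exponent_pos p
  rw [norm_powerSum, norm_powerSum]
  have h1 : ∑ i, ‖T (f i)‖ ^ p ≤ ‖T‖ ^ p * ∑ i, ‖f i‖ ^ p := by
    rw [Finset.mul_sum]
    refine Finset.sum_le_sum fun i _ => ?_
    rw [← Real.mul_rpow (norm_nonneg _) (norm_nonneg _)]
    exact Real.rpow_le_rpow (norm_nonneg _) (T.le_opNorm _) hp.le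
  refine (Real.rpow_le_rpow (Finset.sum_nonneg fun i _ => by positivity) h1
    (by positivity)).trans_eq ?_
  rw [Real.mul_rpow (by positivity) (Finset.sum_nonneg fun i _ => by positivity),
    rpow_rpow_one_div p (norm_nonneg _)]

theorem isLatticePSumming {E : Type*} [NormedAddCommGroup E] [NormedSpace ℝ E]
    {S : E →L[ℝ] Lp ℝ (ENNReal.ofReal p) m} (hS : IsPSumming p S) :
    IsLatticePSumming p ((equiv m p).symm.toContinuousLinearEquiv.toContinuousLinearMap ∘L S) := by
  obtain ⟨K, hK⟩ := hS
  refine ⟨K, fun n x => ?_⟩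
  rw [norm_powerSum]
  exact hK n x

/-! ### Order continuity of `L^p` and of its dual -/

/-- The numbers `‖f n‖^r` decrease and are bounded below, hence are Cauchy, and their differences
dominate `‖f k - f n‖^r`. It serves `L^p` with `r = p` and its dual with `r = q`. -/
theorem tendsto_of_rpow_superadditive {Z : Type*} [NormedAddCommGroup Z] [CompleteSpace Z]
    {r : ℝ} (hr : 0 < r) {f : ℕ → Z}
    (h : ∀ k n, k ≤ n → ‖f n‖ ^ r + ‖f k - f n‖ ^ r ≤ ‖f k‖ ^ r) : ∃ g, Tendsto f atTop (𝓝 g) := by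
  have hanti : Antitone fun n => ‖f n‖ ^ r := fun k n hkn => by
    have := h k n hkn
    have : 0 ≤ ‖f k - f n‖ ^ r := by positivity
    simp only
    linarith
  have hbdd : BddBelow (Set.range fun n => ‖f n‖ ^ r) :=
    ⟨0, by rintro _ ⟨n, rfl⟩; positivity⟩
  have hc := (tendsto_atTop_ciInf hanti hbdd).cauchySeq
  refine cauchySeq_tendsto_of_complete (Metric.cauchySeq_iff'.2 fun ε hε => ?_)
  obtain ⟨N, hN⟩ := Metric.cauchySeq_iff'.1 hc (ε ^ r) (by positivity)
  refine ⟨N, fun n hn => ?_⟩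
  have h1 := hN n hn
  have h2 := h N n hn
  rw [Real.dist_eq, abs_sub_comm] at h1
  have h3 := (le_abs_self _).trans_lt h1
  rw [dist_comm, dist_eq_norm]
  exact lt_of_not_ge fun h4 => absurd (Real.rpow_le_rpow hε.le h4 hr.le) (by linarith)

theorem norm_rpow_add_le {f g : lpSpace m p} (hf : 0 ≤ f) (hfg : f ≤ g) :
    ‖f‖ ^ p + ‖g - f‖ ^ p ≤ ‖g‖ ^ p := by
  simp only [norm_rpow_eq_integral]
  rw [← integral_add (integrable_abs_rpow _) (integrable_abs_rpow _)]
  refine integral_mono_ae ((integrable_abs_rpow _).add (integrable_abs_rpow _))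
    (integrable_abs_rpow _) ?_
  filter_upwards [nonneg_iff_ae.1 hf, le_iff_ae.1 hfg, toL0_sub g f] with ω h1 h2 h3
  rw [h3, abs_of_nonneg h1, abs_of_nonneg (sub_nonneg.2 h2), abs_of_nonneg (h1.trans h2)]
  have := Real.add_rpow_le_rpow_add h1 (sub_nonneg.2 h2) (Fact.out : 1 < p).le
  rwa [add_sub_cancel] at this

end lpSpace

/-! ### The positive cone -/

namespace BanachFunctionSpace

variable {Ω : Type*} [MeasurableSpace Ω] {μ : Measure Ω} {X : BanachFunctionSpace μ}

/-- The positive cone is closed: the negative part is norm continuous. -/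
theorem nonneg_of_tendsto {f : ℕ → X} {g : X} (hf : Tendsto f atTop (𝓝 g))
    (h0 : ∀ᶠ n in atTop, 0 ≤ f n) : 0 ≤ g := by
  obtain ⟨d, hd⟩ := exists_posPart (-g)
  have h1 : ∀ᶠ n in atTop, ‖d‖ ≤ ‖f n - g‖ := h0.mono fun n hn => norm_le_norm_of_ae (by
    filter_upwards [hd, toL0_neg g, toL0_sub (f n) g, nonneg_iff_ae.1 hn] with ω h1 h2 h3 h4
    rw [h1, h2, h3, abs_of_nonneg (le_max_right _ _)]
    refine max_le (le_trans ?_ (le_abs_self _)) (abs_nonneg _)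
    linarith)
  have h2 : ‖d‖ ≤ 0 := ge_of_tendsto (tendsto_iff_norm_sub_tendsto_zero.1 hf) h1
  have h3 : d = 0 := norm_le_zero_iff.1 h2
  rw [nonneg_iff_ae]
  filter_upwards [hd, toL0_neg g, toL0_zero (X := X)] with ω h4 h5 h6
  rw [h3, h6, h5] at h4
  have := le_max_left (-toL0 g ω) 0
  linarith

theorem sub_nonneg_iff {f g : X} : 0 ≤ g - f ↔ f ≤ g := by
  rw [nonneg_iff_ae, le_iff_ae]
  refine eventually_congr ?_
  filter_upwards [toL0_sub g f] with ω h
  rw [h, sub_nonneg]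

theorem exists_posPart_sub (f : X) : ∃ g h : X, 0 ≤ g ∧ 0 ≤ h ∧ f = g - h ∧
    ∀ᵐ ω ∂μ, toL0 g ω + toL0 h ω = |toL0 f ω| := by
  obtain ⟨g, hg⟩ := exists_posPart f
  obtain ⟨h, hh⟩ := exists_posPart (-f)
  refine ⟨g, h, ?_, ?_, ?_, ?_⟩
  · rw [nonneg_iff_ae]
    exact hg.mono fun ω h => by rw [h]; exact le_max_right _ _
  · rw [nonneg_iff_ae]
    exact hh.mono fun ω h => by rw [h]; exact le_max_right _ _
  · refine ext_ae ?_
    filter_upwards [hg, hh, toL0_sub g h, toL0_neg f] with ω h1 h2 h3 h4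
    rw [h3, h1, h2, h4]
    rcases le_total (toL0 f ω) 0 with h | h <;> simp [h]
  · filter_upwards [hg, hh, toL0_neg f] with ω h1 h2 h4
    rw [h1, h2, h4]
    rcases le_total (toL0 f ω) 0 with h | h
    · simp [h, abs_of_nonpos]
    · simp [h, abs_of_nonneg]

end BanachFunctionSpace

open BanachFunctionSpace in
-- Superadditivity gives a norm limit; as the cone is closed, this limit lies between 0 and every `f
-- n`, so it is 0.
theorem lpSpace.isOrderContinuous {Ω : Type*} [MeasurableSpace Ω] {m : Measure Ω}
    [IsFiniteMeasure m] {p : ℝ} [Fact (1 < p)] : IsOrderContinuous (lpSpace m p) := by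
  intro f hf hglb
  have h0 : ∀ n, 0 ≤ f n := fun n => hglb.1 ⟨n, rfl⟩
  obtain ⟨g, hg⟩ := tendsto_of_rpow_superadditive (exponent_pos p) (f := f)
    fun k n hkn => norm_rpow_add_le (h0 n) (hf hkn)
  have hg0 : 0 ≤ g := nonneg_of_tendsto hg (Eventually.of_forall h0)
  have hgle : ∀ n, g ≤ f n := fun n => sub_nonneg_iff.1 <|
    nonneg_of_tendsto (tendsto_const_nhds.sub hg)
      ((eventually_ge_atTop n).mono fun k hk => sub_nonneg_iff.2 (hf hk))
  have hg1 : g = 0 := le_antisymm (hglb.2 (by rintro _ ⟨n, rfl⟩; exact hgle n)) hg0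
  rw [hg1] at hg
  simpa using hg.norm

/-! ### Positive functionals and their construction from the cone -/

namespace BanachFunctionSpace

variable {Ω : Type*} [MeasurableSpace Ω] {μ : Measure Ω} {X : BanachFunctionSpace μ}
  {p q : ℝ} [Fact (1 < p)]

theorem le_powerSum {n : ℕ} (u : Fin n → X) (i : Fin n) : u i ≤ powerSum p u := by
  rw [le_iff_ae]
  filter_upwards [toL0_powerSum (p := p) u] with ω h
  rw [h]
  have hp := exponent_pos p
  refine (le_abs_self _).trans ?_
  rw [← rpow_rpow_one_div p (abs_nonneg (toL0 (u i) ω))]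
  exact Real.rpow_le_rpow (by positivity) (Finset.single_le_sum
    (f := fun i => |toL0 (u i) ω| ^ p) (fun i _ => by positivity) (Finset.mem_univ i))
    (by positivity)

theorem powerSum_nonneg {n : ℕ} (u : Fin n → X) : 0 ≤ powerSum p u := by
  rw [nonneg_iff_ae]
  filter_upwards [toL0_powerSum (p := p) u] with ω h
  rw [h]
  have : 0 ≤ ∑ i, |toL0 (u i) ω| ^ p := Finset.sum_nonneg fun i _ => by positivity
  positivity

theorem norm_le_norm_of_le {f g : X} (hf : 0 ≤ f) (hfg : f ≤ g) : ‖f‖ ≤ ‖g‖ :=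
  norm_le_norm_of_nonneg (by
    filter_upwards [nonneg_iff_ae.1 hf, le_iff_ae.1 hfg] with ω h1 h2
    rwa [abs_of_nonneg h1])

theorem apply_mono {α : StrongDual ℝ X} (hα : 0 ≤ α) {f g : X} (hfg : f ≤ g) : α f ≤ α g := by
  have h : 0 ≤ α (g - f) := hα (g - f) (sub_nonneg_iff.2 hfg)
  rw [map_sub] at h
  linarith

theorem add_nonneg_elem {f g : X} (hf : 0 ≤ f) (hg : 0 ≤ g) : 0 ≤ f + g := by
  rw [nonneg_iff_ae] at *
  filter_upwards [hf, hg, toL0_add f g] with ω h1 h2 h3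
  rw [h3]
  exact add_nonneg h1 h2

/-- An additive, positive and bounded function on the positive cone extends to the whole space. -/
theorem exists_dual_of_additive {P : X → ℝ} {M : ℝ} (hM : 0 ≤ M)
    (hadd : ∀ f g : X, 0 ≤ f → 0 ≤ g → P (f + g) = P f + P g)
    (hpos : ∀ f : X, 0 ≤ f → 0 ≤ P f) (hbd : ∀ f : X, 0 ≤ f → P f ≤ M * ‖f‖) :
    ∃ ψ : StrongDual ℝ X, (∀ f, 0 ≤ f → ψ f = P f) ∧ ‖ψ‖ ≤ M := by
  choose g h hg hh hfgh hab using exists_posPart_sub (X := X)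
  -- Independence of the chosen decomposition is what makes the extension additive.
  have hdec : ∀ f a b : X, 0 ≤ a → 0 ≤ b → f = a - b → P (g f) - P (h f) = P a - P b := by
    intro f a b ha hb hf
    have h1 : g f + b = a + h f := by
      have h2 := hfgh f
      rw [hf] at h2 ⊢
      rw [eq_comm, ← sub_eq_zero]
      have h3 : a - b - (g (a - b) - h (a - b)) = 0 := sub_eq_zero.2 h2
      rw [← h3]; abel
    have h2 := congrArg P h1
    rw [hadd _ _ (hg f) hb, hadd _ _ ha (hh f)] at h2
    linarith
  let ψ₀ : X →+ ℝ := AddMonoidHom.mk' (fun f => P (g f) - P (h f)) fun f₁ f₂ => by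
    have h1 := hdec (f₁ + f₂) (g f₁ + g f₂) (h f₁ + h f₂) (add_nonneg_elem (hg _) (hg _))
      (add_nonneg_elem (hh _) (hh _)) (by
        conv_lhs => rw [hfgh f₁, hfgh f₂]
        abel)
    rw [h1, hadd _ _ (hg _) (hg _), hadd _ _ (hh _) (hh _)]
    ring
  have hbound : ∀ f, ‖ψ₀ f‖ ≤ M * ‖f‖ := fun f => by
    have h1 : ‖g f + h f‖ ≤ ‖f‖ := norm_le_norm_of_ae (by
      filter_upwards [hab f, toL0_add (g f) (h f)] with ω h1 h2
      rw [h2, h1, abs_abs])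
    have h2 := hbd _ (add_nonneg_elem (hg f) (hh f))
    rw [hadd _ _ (hg f) (hh f)] at h2
    have h3 := mul_le_mul_of_nonneg_left h1 hM
    have h4 := hpos _ (hg f)
    have h5 := hpos _ (hh f)
    change |P (g f) - P (h f)| ≤ _
    rw [abs_le]
    constructor <;> linarith
  -- Homogeneity of `P` is not assumed: a continuous additive map is automatically real linear.
  have hcont : Continuous ψ₀ := AddMonoidHomClass.continuous_of_bound ψ₀ M hbound
  refine ⟨ψ₀.toRealLinearMap hcont, fun f hf => ?_, ContinuousLinearMap.opNorm_le_bound _ hM hbound⟩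
  have h1 := hdec f f 0 hf le_rfl (by simp)
  have h2 : P 0 = 0 := by
    have := hadd 0 0 le_rfl le_rfl
    rw [add_zero] at this
    linarith
  rw [h2, sub_zero] at h1
  exact h1

end BanachFunctionSpace

namespace lpSpace

open BanachFunctionSpace

variable {Ω : Type*} [MeasurableSpace Ω] {m : Measure Ω} [IsFiniteMeasure m] {p q : ℝ}
  [Fact (1 < p)]

/-- By positivity `α(u₀) + β(u₁) ≤ (α + β)((|u₀|^p + |u₁|^p)^{1/p})`, and the power sum has norm
`(‖u₀‖^p + ‖u₁‖^p)^{1/p}`; duality does the rest. -/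
theorem norm_dual_rpow_add_le (hpq : p.HolderConjugate q) {α β : StrongDual ℝ (lpSpace m p)}
    (hα : 0 ≤ α) (hβ : 0 ≤ β) : ‖α‖ ^ q + ‖β‖ ^ q ≤ ‖α + β‖ ^ q := by
  have hq := hpq.symm.pos
  have h1 := sum_norm_rpow_le_of_forall_sum_apply_le hpq ![α, β] (norm_nonneg (α + β)) fun u => by
    have h2 : α (u 0) ≤ α (powerSum p u) := apply_mono hα (le_powerSum u 0)
    have h3 : β (u 1) ≤ β (powerSum p u) := apply_mono hβ (le_powerSum u 1)
    have h4 := (le_abs_self _).trans ((α + β).le_opNorm (powerSum p u))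
    rw [← norm_powerSum]
    simp only [_root_.add_apply] at h4
    simp only [Fin.sum_univ_two, Matrix.cons_val_zero, Matrix.cons_val_one]
    linarith
  simp only [Fin.sum_univ_two, Matrix.cons_val_zero, Matrix.cons_val_one] at h1
  have h0 : 0 ≤ ‖α‖ ^ q + ‖β‖ ^ q := by positivity
  have h2 := Real.rpow_le_rpow (by positivity) h1 hq.le
  rwa [← Real.rpow_mul h0, one_div_mul_cancel hq.ne', Real.rpow_one] at h2

theorem isOrderContinuous_dual (hpq : p.HolderConjugate q) :
    IsOrderContinuous (StrongDual ℝ (lpSpace m p)) := by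
  intro φ hφ hglb
  have h0 : ∀ n, 0 ≤ φ n := fun n => hglb.1 ⟨n, rfl⟩
  obtain ⟨g, hg⟩ := tendsto_of_rpow_superadditive hpq.symm.pos (f := φ) fun k n hkn => by
    have h1 : 0 ≤ φ k - φ n := fun f hf => by
      have := hφ hkn f hf
      simp only [_root_.zero_apply, _root_.sub_apply]
      linarith
    have h2 := norm_dual_rpow_add_le hpq (h0 n) h1
    rwa [add_sub_cancel] at h2
  have hgf : ∀ f, Tendsto (fun n => φ n f) atTop (𝓝 (g f)) := fun f =>
    ((ContinuousLinearMap.apply ℝ ℝ f).continuous.tendsto g).comp hg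
  have hgle : g ≤ 0 := hglb.2 (by
    rintro _ ⟨n, rfl⟩ f hf
    exact le_of_tendsto (hgf f) ((eventually_ge_atTop n).mono fun k hk => hφ hk f hf))
  -- The dual order is available only as a preorder, so `g = 0` is checked on the cone, which spans
  -- the space.
  have hg0 : ∀ f, 0 ≤ f → g f = 0 := fun f hf =>
    le_antisymm (hgle f hf) (ge_of_tendsto' (hgf f) fun n => h0 n f hf)
  have hgz : g = 0 := by
    ext f
    obtain ⟨a, b, ha, hb, hab, -⟩ := exists_posPart_sub f
    rw [hab, map_sub, hg0 a ha, hg0 b hb]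
    simp
  rw [hgz] at hg
  simpa using hg.norm

/-! ### Power sums in the dual of `L^p` -/

/-- The values `∑ φ_i(h_i)` over all families with `(∑ |h_i|^p)^{1/p} ≤ f`. -/
def dualValues {n : ℕ} (φ : Fin n → StrongDual ℝ (lpSpace m p)) (f : lpSpace m p) : Set ℝ :=
  {r | ∃ h : Fin n → lpSpace m p, powerSum p h ≤ f ∧ r = ∑ i, φ i (h i)}

theorem zero_mem_dualValues {n : ℕ} (φ : Fin n → StrongDual ℝ (lpSpace m p)) {f : lpSpace m p}
    (hf : 0 ≤ f) : 0 ∈ dualValues φ f := by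
  refine ⟨0, ?_, by simp⟩
  have hp := exponent_pos p
  have : powerSum p (0 : Fin n → lpSpace m p) = 0 := by
    rw [← norm_eq_zero, norm_powerSum]
    simp [Real.zero_rpow hp.ne', Real.zero_rpow (inv_pos.2 hp).ne']
  rwa [this]

theorem le_of_mem_dualValues (hpq : p.HolderConjugate q) {n : ℕ}
    {φ : Fin n → StrongDual ℝ (lpSpace m p)} {f : lpSpace m p} {r : ℝ} (hr : r ∈ dualValues φ f) :
    r ≤ (∑ i, ‖φ i‖ ^ q) ^ (1 / q) * ‖f‖ := by
  obtain ⟨h, hh, rfl⟩ := hr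
  have hs : 0 ≤ ∑ i, ‖φ i‖ ^ q := Finset.sum_nonneg fun i _ => by positivity
  calc ∑ i, φ i (h i) ≤ ∑ i, ‖φ i‖ * ‖h i‖ :=
        Finset.sum_le_sum fun i _ => (le_abs_self _).trans ((φ i).le_opNorm _)
    _ ≤ (∑ i, ‖φ i‖ ^ q) ^ (1 / q) * (∑ i, ‖h i‖ ^ p) ^ (1 / p) :=
        Real.inner_le_Lp_mul_Lq_of_nonneg Finset.univ hpq.symm (fun i _ => norm_nonneg _)
          fun i _ => norm_nonneg _
    _ ≤ _ := by
        rw [← norm_powerSum]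
        exact mul_le_mul_of_nonneg_left (norm_le_norm_of_le (powerSum_nonneg h) hh) (by positivity)

open Pointwise in
-- Riesz decomposition: a family below `f + g` is split by multiplying with `f / (f + g)` and its
-- complement to 1, the quotient being 0 where `f + g = 0`. The converse is Minkowski's inequality.
theorem dualValues_add {n : ℕ} (φ : Fin n → StrongDual ℝ (lpSpace m p)) {f g : lpSpace m p}
    (hf : 0 ≤ f) (hg : 0 ≤ g) : dualValues φ (f + g) = dualValues φ f + dualValues φ g := by
  have hp := exponent_pos p
  ext r
  rw [Set.mem_add]
  constructor
  · rintro ⟨h, hh, rfl⟩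
    have hcm : Measurable fun ω => toL0 f ω / (toL0 f ω + toL0 g ω) :=
      (toL0 f).measurable.div ((toL0 f).measurable.add (toL0 g).measurable)
    have hc01 : ∀ᵐ ω ∂m, 0 ≤ toL0 f ω / (toL0 f ω + toL0 g ω) ∧
        toL0 f ω / (toL0 f ω + toL0 g ω) ≤ 1 := by
      filter_upwards [nonneg_iff_ae.1 hf, nonneg_iff_ae.1 hg] with ω h1 h2
      exact ⟨by positivity, div_le_one_of_le₀ (by linarith) (by positivity)⟩
    choose k hk using fun i => exists_mul (X := lpSpace m p) hcm.aestronglyMeasurable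
      (hc01.mono fun ω h => by rw [abs_of_nonneg h.1]; exact h.2) (h i)
    have hscale : ∀ (c : ℝ) (a : Fin n → ℝ), 0 ≤ c →
        (∑ i, |c * a i| ^ p) ^ (1 / p) = c * (∑ i, |a i| ^ p) ^ (1 / p) := fun c a hc => by
      have : ∀ i, |c * a i| ^ p = c ^ p * |a i| ^ p := fun i => by
        rw [abs_mul, abs_of_nonneg hc, Real.mul_rpow hc (abs_nonneg _)]
      simp only [this]
      rw [← Finset.mul_sum, Real.mul_rpow (by positivity)
        (Finset.sum_nonneg fun i _ => by positivity), rpow_rpow_one_div p hc]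
    refine ⟨_, ⟨k, ?_, rfl⟩, _, ⟨fun i => h i - k i, ?_, rfl⟩, ?_⟩
    · rw [le_iff_ae] at hh ⊢
      filter_upwards [hh, toL0_powerSum (p := p) h, toL0_powerSum (p := p) k, ae_all_iff.2 hk, hc01,
        nonneg_iff_ae.1 hf, nonneg_iff_ae.1 hg, toL0_add f g] with ω h1 h2 h3 h4 h5 h6 h7 h8
      rw [h3]
      simp only [h4]
      rw [hscale _ _ h5.1, ← h2]
      refine (mul_le_mul_of_nonneg_left h1 h5.1).trans ?_
      rw [h8]
      rcases (add_nonneg h6 h7).eq_or_lt with h | h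
      · rw [← h]; simpa using h6
      · rw [div_mul_cancel₀ _ h.ne']
    · rw [le_iff_ae] at hh ⊢
      filter_upwards [hh, toL0_powerSum (p := p) h, toL0_powerSum (p := p) fun i => h i - k i,
        ae_all_iff.2 hk, hc01, nonneg_iff_ae.1 hf, nonneg_iff_ae.1 hg, toL0_add f g,
        ae_all_iff.2 fun i => toL0_sub (h i) (k i)] with ω h1 h2 h3 h4 h5 h6 h7 h8 h9
      have e : ∀ i, toL0 (h i) ω - toL0 f ω / (toL0 f ω + toL0 g ω) * toL0 (h i) ω
          = (1 - toL0 f ω / (toL0 f ω + toL0 g ω)) * toL0 (h i) ω := fun i => by ring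
      rw [h3]
      simp only [h9, h4, e]
      rw [hscale _ _ (sub_nonneg.2 h5.2), ← h2]
      refine (mul_le_mul_of_nonneg_left h1 (sub_nonneg.2 h5.2)).trans ?_
      rw [h8]
      rcases (add_nonneg h6 h7).eq_or_lt with h | h
      · rw [← h]; simpa using h7
      · rw [sub_mul, div_mul_cancel₀ _ h.ne']; linarith
    · rw [← Finset.sum_add_distrib]
      refine Finset.sum_congr rfl fun i _ => ?_
      rw [map_sub]; ring
  · rintro ⟨_, ⟨h, hh, rfl⟩, _, ⟨k, hk, rfl⟩, rfl⟩
    refine ⟨fun i => h i + k i, ?_, ?_⟩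
    · rw [le_iff_ae] at *
      filter_upwards [hh, hk, toL0_powerSum (p := p) h, toL0_powerSum (p := p) k,
        toL0_powerSum (p := p) fun i => h i + k i, toL0_add f g,
        ae_all_iff.2 fun i => toL0_add (h i) (k i)] with ω h1 h2 h3 h4 h5 h6 h7
      rw [h3] at h1
      rw [h4] at h2
      rw [h5, h6]
      simp only [h7]
      exact (Real.Lp_add_le Finset.univ _ _ (Fact.out : 1 < p).le).trans (add_le_add h1 h2)
    · rw [← Finset.sum_add_distrib]
      exact Finset.sum_congr rfl fun i _ => (map_add _ _ _).symm

/-- Riesz–Kantorovich: the supremum of `dualValues` is additive on the cone and extends to `ψ`, with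
the norm bound from Hölder. The families `a_i f` show that `ψ` is an upper bound; it is least by
`sum_apply_le_apply_powerSum`. -/
theorem exists_isDualPowerSum (hpq : p.HolderConjugate q) {n : ℕ}
    (φ : Fin n → StrongDual ℝ (lpSpace m p)) :
    ∃ ψ, IsDualPowerSum q φ ψ ∧ ‖ψ‖ ≤ (∑ i, ‖φ i‖ ^ q) ^ (1 / q) := by
  have hp := exponent_pos p
  have hs : 0 ≤ ∑ i, ‖φ i‖ ^ q := Finset.sum_nonneg fun i _ => by positivity
  have hbdd : ∀ f, BddAbove (dualValues φ f) := fun f =>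
    ⟨_, fun _ hr => le_of_mem_dualValues hpq hr⟩
  obtain ⟨ψ, hψ, hψn⟩ := exists_dual_of_additive (X := lpSpace m p)
    (P := fun f => sSup (dualValues φ f)) (M := (∑ i, ‖φ i‖ ^ q) ^ (1 / q)) (by positivity)
    (fun f g hf hg => by
      rw [dualValues_add φ hf hg]
      exact csSup_add ⟨0, zero_mem_dualValues φ hf⟩ (hbdd f) ⟨0, zero_mem_dualValues φ hg⟩ (hbdd g))
    (fun f hf => le_csSup (hbdd f) (zero_mem_dualValues φ hf))
    (fun f hf => csSup_le ⟨0, zero_mem_dualValues φ hf⟩ fun r hr => le_of_mem_dualValues hpq hr)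
  refine ⟨ψ, ⟨?_, fun χ hχ f hf => ?_⟩, hψn⟩
  · rintro _ ⟨a, ha, rfl⟩ f hf
    rw [hpq.symm.conjExponent_eq] at ha
    rw [hψ f hf]
    refine le_csSup (hbdd f) ⟨fun i => a i • f, ?_, by simp [_root_.sum_apply]⟩
    rw [le_iff_ae]
    filter_upwards [toL0_powerSum (p := p) fun i => a i • f, ae_all_iff.2 fun i => toL0_smul (a i) f,
      nonneg_iff_ae.1 hf] with ω h1 h2 h3
    rw [h1]
    have : ∀ i, |a i * toL0 f ω| ^ p = |a i| ^ p * toL0 f ω ^ p := fun i => by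
      rw [abs_mul, abs_of_nonneg h3, Real.mul_rpow (abs_nonneg _) h3]
    simp only [h2, this]
    have h0 : 0 ≤ ∑ i, |a i| ^ p := Finset.sum_nonneg fun i _ => by positivity
    rw [← Finset.sum_mul, Real.mul_rpow h0 (by positivity), rpow_rpow_one_div p h3]
    exact mul_le_of_le_one_left h3 (Real.rpow_le_one h0 ha (by positivity))
  · rw [hψ f hf]
    have hub : ∀ a : Fin n → ℝ, ∑ i, |a i| ^ p ≤ 1 → ∑ i, a i • φ i ≤ χ := fun a ha =>
      hχ ⟨a, by rwa [hpq.symm.conjExponent_eq], rfl⟩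
    have hχ0 : 0 ≤ χ := by
      have := hub 0 (by simp [Real.zero_rpow hp.ne'])
      simpa using this
    refine csSup_le ⟨0, zero_mem_dualValues φ hf⟩ ?_
    rintro _ ⟨h, hh, rfl⟩
    exact (sum_apply_le_apply_powerSum hub h).trans (apply_mono hχ0 hh)

theorem isDualLatticePSumming {F : Type*} [NormedAddCommGroup F] [NormedSpace ℝ F]
    (hpq : p.HolderConjugate q) {R : Lp ℝ (ENNReal.ofReal p) m →L[ℝ] F}
    (hR : IsPSumming q (adjointOp R)) : IsDualLatticePSumming q
      (adjointOp (R ∘L (equiv m p).toContinuousLinearEquiv.toContinuousLinearMap)) := by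
  obtain ⟨K, hK⟩ := hR
  refine ⟨K, fun n φ => ?_⟩
  obtain ⟨ψ, hψ, hn⟩ := exists_isDualPowerSum hpq fun i =>
    adjointOp (R ∘L (equiv m p).toContinuousLinearEquiv.toContinuousLinearMap) (φ i)
  refine ⟨ψ, hψ, hn.trans (le_trans ?_ (hK n φ))⟩
  have hq := hpq.symm.pos
  refine Real.rpow_le_rpow (Finset.sum_nonneg fun i _ => by positivity)
    (Finset.sum_le_sum fun i _ => Real.rpow_le_rpow (norm_nonneg _) ?_ hq.le) (by positivity)
  exact ContinuousLinearMap.opNorm_le_bound _ (norm_nonneg _) fun f =>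
    (adjointOp R (φ i)).le_opNorm (equiv m p f)

end lpSpace

/-! ### Domination -/

theorem weakNorm_nonneg {E : Type*} [NormedAddCommGroup E] [NormedSpace ℝ E] (p : ℝ) {n : ℕ}
    (x : Fin n → E) : 0 ≤ weakNorm p x :=
  Real.iSup_nonneg fun _ => Real.rpow_nonneg
    (Finset.sum_nonneg fun _ _ => Real.rpow_nonneg (abs_nonneg _) _) _

theorem weakStarNorm_nonneg {F : Type*} [NormedAddCommGroup F] [NormedSpace ℝ F] (q : ℝ) {n : ℕ}
    (φ : Fin n → StrongDual ℝ F) : 0 ≤ weakStarNorm q φ :=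
  Real.iSup_nonneg fun _ => Real.rpow_nonneg
    (Finset.sum_nonneg fun _ _ => Real.rpow_nonneg (abs_nonneg _) _) _

theorem le_weakStarNorm {F : Type*} [NormedAddCommGroup F] [NormedSpace ℝ F] {q : ℝ} (hq : 0 < q)
    {n : ℕ} (φ : Fin n → StrongDual ℝ F) {y : F} (hy : ‖y‖ ≤ 1) :
    (∑ i, |φ i y| ^ q) ^ (1 / q) ≤ weakStarNorm q φ := by
  refine le_ciSup (f := fun y : Metric.closedBall (0 : F) 1 => (∑ i, |φ i y.1| ^ q) ^ (1 / q))
    ⟨(∑ i, ‖φ i‖ ^ q) ^ (1 / q), ?_⟩ ⟨y, by simpa using hy⟩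
  rintro _ ⟨⟨z, hz⟩, rfl⟩
  have hz' : ‖z‖ ≤ 1 := by simpa using hz
  refine Real.rpow_le_rpow (Finset.sum_nonneg fun i _ => by positivity)
    (Finset.sum_le_sum fun i _ => Real.rpow_le_rpow (abs_nonneg _) ?_ hq.le) (by positivity)
  exact ((φ i).le_opNorm z).trans (mul_le_of_le_one_right (norm_nonneg _) hz')

/-- The supremum over the unit ball of `F` dominates the one over the unit ball of `F^{**}`. -/
theorem weakNorm_le_weakStarNorm {F : Type*} [NormedAddCommGroup F] [NormedSpace ℝ F] {p q : ℝ}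
    (hpq : p.HolderConjugate q) {n : ℕ} (φ : Fin n → StrongDual ℝ F) :
    weakNorm q φ ≤ weakStarNorm q φ := by
  have hp := hpq.pos
  have hq := hpq.symm.pos
  have : Nonempty (Metric.closedBall (0 : StrongDual ℝ (StrongDual ℝ F)) 1) := ⟨⟨0, by simp⟩⟩
  refine ciSup_le fun ⟨Φ, hΦ⟩ => ?_
  have hΦ' : ‖Φ‖ ≤ 1 := by simpa using hΦ
  refine sum_rpow_le_of_forall_sum_le hpq (fun i => abs_nonneg _) (fun t ht => ?_)
    (weakStarNorm_nonneg q φ)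
  have hst : 0 ≤ ∑ i, t i ^ p := Finset.sum_nonneg fun i _ => Real.rpow_nonneg (ht i) p
  -- With these signs `Φ` is tested on the single functional `∑ a_i φ_i`, whose norm is computed on
  -- the unit ball of `F`. This replaces weak-star density of that ball in the bidual ball.
  let a : Fin n → ℝ := fun i => if 0 ≤ Φ (φ i) then t i else -t i
  have ha : ∀ i, |a i| = t i := fun i => by
    by_cases h : 0 ≤ Φ (φ i) <;> simp [a, h, abs_of_nonneg (ht i)]
  have haΦ : ∀ i, t i * |Φ (φ i)| = a i * Φ (φ i) := fun i => by
    by_cases h : 0 ≤ Φ (φ i)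
    · simp [a, h]
    · simp [a, h, abs_of_neg (not_le.1 h)]
  have hW0 := weakStarNorm_nonneg q φ
  have hnorm : ‖∑ i, a i • φ i‖ ≤ weakStarNorm q φ * (∑ i, t i ^ p) ^ (1 / p) := by
    refine ContinuousLinearMap.opNorm_le_of_unit_norm (by positivity) fun y hy => ?_
    have h1 : ‖(∑ i, a i • φ i) y‖ ≤ ∑ i, t i * |φ i y| := by
      rw [_root_.sum_apply]
      refine (norm_sum_le _ _).trans (Finset.sum_le_sum fun i _ => ?_)
      rw [_root_.smul_apply, smul_eq_mul, norm_mul, Real.norm_eq_abs, Real.norm_eq_abs, ha]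
    refine h1.trans ((Real.inner_le_Lp_mul_Lq_of_nonneg Finset.univ hpq (fun i _ => ht i)
      fun i _ => abs_nonneg _).trans ?_)
    rw [mul_comm]
    exact mul_le_mul_of_nonneg_right (le_weakStarNorm hq φ hy.le) (by positivity)
  calc ∑ i, t i * |Φ (φ i)| = Φ (∑ i, a i • φ i) := by
        rw [map_sum]
        exact Finset.sum_congr rfl fun i _ => by rw [haΦ, map_smul, smul_eq_mul]
    _ ≤ ‖Φ‖ * ‖∑ i, a i • φ i‖ := (le_abs_self _).trans (Φ.le_opNorm _)
    _ ≤ ‖∑ i, a i • φ i‖ := mul_le_of_le_one_left (norm_nonneg _) hΦ'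
    _ ≤ _ := hnorm

theorem isPDominated_of_isPSumming {E F G H : Type*} [NormedAddCommGroup E] [NormedSpace ℝ E]
    [NormedAddCommGroup F] [NormedSpace ℝ F] [NormedAddCommGroup G] [NormedSpace ℝ G]
    [NormedAddCommGroup H] [NormedSpace ℝ H] {p q : ℝ} (hpq : p.HolderConjugate q)
    {S : E →L[ℝ] G} (T : G →L[ℝ] H) {R : H →L[ℝ] F} (hS : IsPSumming p S)
    (hR : IsPSumming q (adjointOp R)) : IsPDominated p q (R ∘L T ∘L S) := by
  obtain ⟨K, hK⟩ := hS
  obtain ⟨C, hC⟩ := hR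
  -- Since `⟨RTSx, φ⟩ = ⟨TSx, R^*φ⟩`, each term is at most `‖T‖ ‖Sx‖ ‖R^*φ‖`, and Hölder separates
  -- the two summing bounds.
  refine ⟨‖T‖ * (|K| * |C|), fun n x φ => ?_⟩
  have h1 : (∑ i, ‖S (x i)‖ ^ p) ^ (1 / p) ≤ |K| * weakNorm p x :=
    (hK n x).trans (mul_le_mul_of_nonneg_right (le_abs_self K) (weakNorm_nonneg p x))
  have h2 : (∑ i, ‖adjointOp R (φ i)‖ ^ q) ^ (1 / q) ≤ |C| * weakStarNorm q φ :=
    (hC n φ).trans ((mul_le_mul_of_nonneg_right (le_abs_self C) (weakNorm_nonneg q φ)).trans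
      (mul_le_mul_of_nonneg_left (weakNorm_le_weakStarNorm hpq φ) (abs_nonneg C)))
  have h3 : ∀ i, |φ i ((R ∘L T ∘L S) (x i))| ≤ ‖T‖ * (‖S (x i)‖ * ‖adjointOp R (φ i)‖) := fun i =>
    calc |φ i ((R ∘L T ∘L S) (x i))| ≤ ‖adjointOp R (φ i)‖ * ‖T (S (x i))‖ :=
          (adjointOp R (φ i)).le_opNorm (T (S (x i)))
      _ ≤ ‖adjointOp R (φ i)‖ * (‖T‖ * ‖S (x i)‖) :=
          mul_le_mul_of_nonneg_left (T.le_opNorm _) (norm_nonneg _)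
      _ = _ := by ring
  calc ∑ i, |φ i ((R ∘L T ∘L S) (x i))|
      ≤ ∑ i, ‖T‖ * (‖S (x i)‖ * ‖adjointOp R (φ i)‖) := Finset.sum_le_sum fun i _ => h3 i
    _ = ‖T‖ * ∑ i, ‖S (x i)‖ * ‖adjointOp R (φ i)‖ := by rw [Finset.mul_sum]
    _ ≤ ‖T‖ * ((∑ i, ‖S (x i)‖ ^ p) ^ (1 / p) * (∑ i, ‖adjointOp R (φ i)‖ ^ q) ^ (1 / q)) :=
        mul_le_mul_of_nonneg_left (Real.inner_le_Lp_mul_Lq_of_nonneg Finset.univ hpq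
          (fun i _ => norm_nonneg _) fun i _ => norm_nonneg _) (norm_nonneg _)
    _ ≤ ‖T‖ * ((|K| * weakNorm p x) * (|C| * weakStarNorm q φ)) := by
        refine mul_le_mul_of_nonneg_left (mul_le_mul h1 h2 ?_ ?_) (norm_nonneg _)
        · exact Real.rpow_nonneg (Finset.sum_nonneg fun i _ => by positivity) _
        · exact mul_nonneg (abs_nonneg _) (weakNorm_nonneg p x)
    _ = _ := by ring

/-! ### Assembly of the equivalence and its consequences -/

theorem mainTheorem10 {E : Type u} {F : Type v}
    [NormedAddCommGroup E] [NormedSpace ℝ E] [CompleteSpace E]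
    [NormedAddCommGroup F] [NormedSpace ℝ F] [CompleteSpace F]
    (p q : ℝ) [Fact (1 < p)] (hpq : p.HolderConjugate q) (T : E →L[ℝ] F) :
    ((∃ (Ω₁ Ω₂ : Type w) (_ : MeasurableSpace Ω₁) (_ : MeasurableSpace Ω₂)
        (μ : Measure Ω₁) (ν : Measure Ω₂) (_ : IsFiniteMeasure μ) (_ : IsFiniteMeasure ν)
        (X : BanachFunctionSpace μ) (Y : BanachFunctionSpace ν)
        (S₀ : E →L[ℝ] X) (T₀ : X →L[ℝ] Y) (R₀ : Y →L[ℝ] F),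
        X.IsPConvex p ∧ IsOrderContinuous X ∧
        Y.IsPConcave p ∧ IsOrderContinuous (StrongDual ℝ Y) ∧
        IsLatticePSumming p S₀ ∧ IsPRegular p T₀ ∧ IsDualLatticePSumming q (adjointOp R₀) ∧
        T = R₀ ∘L T₀ ∘L S₀) ↔
      (∃ (Ω₁ Ω₂ : Type w) (_ : MeasurableSpace Ω₁) (_ : MeasurableSpace Ω₂)
        (μ : Measure Ω₁) (ν : Measure Ω₂) (_ : IsFiniteMeasure μ) (_ : IsFiniteMeasure ν)
        (S₁ : E →L[ℝ] Lp ℝ (ENNReal.ofReal p) μ)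
        (T₁ : Lp ℝ (ENNReal.ofReal p) μ →L[ℝ] Lp ℝ (ENNReal.ofReal p) ν)
        (R₁ : Lp ℝ (ENNReal.ofReal p) ν →L[ℝ] F),
        IsPSumming p S₁ ∧ IsPSumming q (adjointOp R₁) ∧ T = R₁ ∘L T₁ ∘L S₁)) ∧
    ((∃ (Ω₁ Ω₂ : Type w) (_ : MeasurableSpace Ω₁) (_ : MeasurableSpace Ω₂)
        (μ : Measure Ω₁) (ν : Measure Ω₂) (_ : IsFiniteMeasure μ) (_ : IsFiniteMeasure ν)
        (S₁ : E →L[ℝ] Lp ℝ (ENNReal.ofReal p) μ)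
        (T₁ : Lp ℝ (ENNReal.ofReal p) μ →L[ℝ] Lp ℝ (ENNReal.ofReal p) ν)
        (R₁ : Lp ℝ (ENNReal.ofReal p) ν →L[ℝ] F),
        IsPSumming p S₁ ∧ IsPSumming q (adjointOp R₁) ∧ T = R₁ ∘L T₁ ∘L S₁) →
      IsPDominated p q T ∧ IsPFactorable.{w} p T) := by
  refine ⟨⟨?_, ?_⟩, ?_⟩
  · rintro ⟨Ω₁, Ω₂, _, _, μ, ν, _, _, X, Y, S₀, T₀, R₀, hX, hoc, hY, -, hS, hT, hR, rfl⟩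
    obtain ⟨m, hm, S₁, R₁, hS₁, hR₁, h⟩ :=
      BanachFunctionSpace.exists_factorization_Lp hpq hX hoc hY hS hT hR
    -- Both `L^p` spaces are `L^p(m)` and the middle operator is the identity, since `T₀` has been
    -- absorbed into `R₁`.
    exact ⟨Ω₁, Ω₁, _, _, m, m, hm, hm, S₁, ContinuousLinearMap.id ℝ _, R₁, hS₁, hR₁, h⟩
  · rintro ⟨Ω₁, Ω₂, _, _, μ, ν, _, _, S₁, T₁, R₁, hS, hR, rfl⟩
    let e := (lpSpace.equiv μ p).toContinuousLinearEquiv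
    let e' := (lpSpace.equiv ν p).toContinuousLinearEquiv
    refine ⟨Ω₁, Ω₂, _, _, μ, ν, ‹_›, ‹_›, lpSpace μ p, lpSpace ν p,
      e.symm.toContinuousLinearMap ∘L S₁,
      e'.symm.toContinuousLinearMap ∘L T₁ ∘L e.toContinuousLinearMap,
      R₁ ∘L e'.toContinuousLinearMap, lpSpace.isPConvex, lpSpace.isOrderContinuous,
      lpSpace.isPConcave, lpSpace.isOrderContinuous_dual hpq, lpSpace.isLatticePSumming hS,
      lpSpace.isPRegular _, lpSpace.isDualLatticePSumming hpq hR, ?_⟩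
    ext x
    simp
  · rintro ⟨Ω₁, Ω₂, _, _, μ, ν, _, _, S₁, T₁, R₁, hS, hR, rfl⟩
    exact ⟨isPDominated_of_isPSumming hpq T₁ hS hR, Ω₁, _, μ, S₁,
      NormedSpace.inclusionInDoubleDual ℝ F ∘L R₁ ∘L T₁, rfl⟩
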